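/- Let $\mathtt L$ be a many-sorted first-order language and let $\mathfrak M$ be a $\kappa$-saturated $\mathtt L$-structure, where $\kappa$ is an uncountable cardinal with $\kappa\ge|\mathtt L|$. "Definable" means definable in $\mathfrak M$ with parameters, and a subset of a definable group $G$ is "type-definable" if it is an intersection of fewer than $\kappa$ definable subsets of $G$. A set $X\subseteq G$ is symmetric if $1\in X=X^{-1}$; $XY$ is the set of products, $X^0=\{1\}$ and $X^{n+1}=XX^{n}$. Let $G$ be a definable group, $A\subseteq G$ a definable symmetric subset, and $(T_i)_{i\in\mathbb N}$ a sequence of definable symmetric subsets of $G$ such that $T_{i+1}T_{i+1}\subseteq T_i$ and $a^{-1}T_{i+1}a\subseteq T_i$ for all $i\in\mathbb N$ and $a\in A$. Put $T=\bigcap_{i\in\mathbb N}T_i$. Assume that $A$ is $(T_i)$-rough definably amenable, witnessed by $(\mu_i)_{i\in\mathbb N}$: for each $i$, $\mu_i$ is a function from the definable subsets of $G$ to $[0,\infty]$ such that, for all definable $X,Y\subseteq G$ and $g\in G$: $\mu_i(X)\le\mu_i(Y)$ if $X\subseteq Y$; $\mu_i(X\cup Y)\le\mu_i(X)+\mu_i(Y)$;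 $\mu_i(X\cup Y)=\mu_i(X)+\mu_i(Y)$ if $X\cap YT_i=\emptyset$; $\mu_i(gX)=\mu_i(X)$; and $\mu_i(A)=1$. For a type-definable set $Y\subseteq G$ write $\mu_i(Y)=\inf\{\mu_i(X): X\supseteq Y \text{ definable}\}$. Suppose that $\mu_i(A^4T)<\infty$ for all $i\in\mathbb N$. Then $\mu_i(A^m)<\infty$ for all $m,i\in\mathbb N$. Moreover, there is a type-definable normal subgroup $N$ of $\langle AT\rangle$ of bounded index such that $T\subseteq N\subseteq A^4T$. Here bounded index means that $[\langle AT\rangle:N]\le 2^{\aleph_0}$ and that, for every definable $D\supseteq N$ and every $n\in\mathbb N$, finitely many left translates of $D$ by elements of $\langle AT\rangle$ cover $(AT)^n$. (The second condition says that the index stays bounded in elementary extensions of $\mathfrak M$.) -/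

import Mathlib

open scoped Pointwise ENNReal Cardinal

universe u

/-! ### Many-sorted first-order logic -/

/-- A many-sorted first-order language: a set of sorts, function symbols with a list of argument
sorts and a value sort, and relation symbols with a list of argument sorts. -/
structure MSLanguage where
  Sorts : Type u
  Func : List Sorts → Sorts → Type u
  Rel : List Sorts → Type u

namespace MSLanguage

/-- The cardinality `|L|`: the number of sorts and symbols, and at least `ℵ₀`. -/
noncomputable def card (L : MSLanguage.{u}) : Cardinal.{u} :=
  max ℵ₀ (#L.Sorts + #(Σ l : List L.Sorts, Σ s : L.Sorts, L.Func l s) +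
    #(Σ l : List L.Sorts, L.Rel l))

/-- Terms of each sort. A context of variables is a family `V`, where `V s` is the set of
variables of sort `s`. -/
inductive Term (L : MSLanguage.{u}) (V : L.Sorts → Type u) : L.Sorts → Type u
  | var {s : L.Sorts} (x : V s) : Term L V s
  | app {l : List L.Sorts} {s : L.Sorts} (f : L.Func l s)
      (ts : ∀ i : Fin l.length, Term L V (l.get i)) : Term L V s

/-- The context `V` with one further variable, of sort `s`. -/
def extend {L : MSLanguage.{u}} (V : L.Sorts → Type u) (s : L.Sorts) : L.Sorts → Type u :=
  fun t => V t ⊕ {_x : PUnit.{u + 1} // t = s}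

/-- First-order formulas with free variables in a context. -/
inductive Formula (L : MSLanguage.{u}) : (L.Sorts → Type u) → Type (u + 1)
  | falsum {V : L.Sorts → Type u} : Formula L V
  | eq {V : L.Sorts → Type u} {s : L.Sorts} (t₁ t₂ : L.Term V s) : Formula L V
  | rel {V : L.Sorts → Type u} {l : List L.Sorts} (R : L.Rel l)
      (ts : ∀ i : Fin l.length, L.Term V (l.get i)) : Formula L V
  | imp {V : L.Sorts → Type u} (φ ψ : Formula L V) : Formula L V
  | all {V : L.Sorts → Type u} (s : L.Sorts) (φ : Formula L (extend V s)) : Formula L V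

/-- A many-sorted `L`-structure. -/
structure Struc (L : MSLanguage.{u}) where
  Carrier : L.Sorts → Type u
  funMap {l : List L.Sorts} {s : L.Sorts} (f : L.Func l s) :
    (∀ i : Fin l.length, Carrier (l.get i)) → Carrier s
  relMap {l : List L.Sorts} (R : L.Rel l) : (∀ i : Fin l.length, Carrier (l.get i)) → Prop

/-- Assignments of elements of `M` to the variables in `V`. If `V` has finitely many variables in
all, this is the product of finitely many sorts of `M`. -/
def Struc.Assign {L : MSLanguage.{u}} (M : L.Struc) (V : L.Sorts → Type u) : Type u :=
  ∀ s : L.Sorts, V s → M.Carrier s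

/-- Extend an assignment by the value `a` at the new variable. -/
def Struc.Assign.snoc {L : MSLanguage.{u}} {M : L.Struc} {V : L.Sorts → Type u}
    (v : M.Assign V) (s : L.Sorts) (a : M.Carrier s) : M.Assign (extend V s) :=
  fun t => Sum.elim (v t) (fun h => h.2.symm ▸ a)

def Term.eval {L : MSLanguage.{u}} (M : L.Struc) {V : L.Sorts → Type u} (v : M.Assign V) :
    {s : L.Sorts} → L.Term V s → M.Carrier s
  | _, .var x => v _ x
  | _, .app f ts => M.funMap f (fun i => (ts i).eval M v)

def Formula.Realize {L : MSLanguage.{u}} (M : L.Struc) :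
    {V : L.Sorts → Type u} → L.Formula V → M.Assign V → Prop
  | _, .falsum, _ => False
  | _, .eq t₁ t₂, v => t₁.eval M v = t₂.eval M v
  | _, .rel R ts, v => M.relMap R (fun i => (ts i).eval M v)
  | _, .imp φ ψ, v => φ.Realize M v → ψ.Realize M v
  | _, .all s φ, v => ∀ a : M.Carrier s, φ.Realize M (v.snoc s a)

namespace Struc

variable {L : MSLanguage.{u}} (M : L.Struc)

/-- `X` is definable in `M` by a formula with parameters from `C`. -/
def DefinableOver (C : ∀ s : L.Sorts, Set (M.Carrier s)) {V : L.Sorts → Type u}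
    (X : Set (M.Assign V)) : Prop :=
  ∃ φ : L.Formula (fun s => V s ⊕ C s),
    ∀ v : M.Assign V, v ∈ X ↔ φ.Realize M (fun s => Sum.elim (v s) (fun c => (c : M.Carrier s)))

/-- `X` is definable in `M`, with arbitrary parameters. -/
def Definable {V : L.Sorts → Type u} (X : Set (M.Assign V)) : Prop :=
  M.DefinableOver (fun _ => Set.univ) X

/-- `κ`-saturation: every partial type in finitely many variables over fewer than `κ` parameters
that is finitely satisfiable in `M` is realised in `M`. -/
def Saturated (κ : Cardinal.{u}) : Prop :=
  ∀ C : ∀ s : L.Sorts, Set (M.Carrier s), #(Σ s : L.Sorts, C s) < κ →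
    ∀ V : L.Sorts → Type u, Finite (Σ s : L.Sorts, V s) →
      ∀ p : Set (Set (M.Assign V)), (∀ X ∈ p, M.DefinableOver C X) →
        (∀ F : Set (Set (M.Assign V)), F ⊆ p → F.Finite → (⋂₀ F).Nonempty) → (⋂₀ p).Nonempty

/-- A presentation of the group `G` as a group definable in `M`: an identification of `G` with a
definable subset of a finite product of sorts, for which the graph of the multiplication is
definable. -/
structure DefinableGroup (G : Type u) [Group G] where
  vars : L.Sorts → Type u
  finite_vars : Finite (Σ s : L.Sorts, vars s)
  coords : G → M.Assign vars
  coords_injective : Function.Injective coords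
  definable_range : M.Definable (Set.range coords)
  definable_mul : M.Definable (V := fun s => Fin 3 × vars s)
    {v | ∃ g h : G, ∀ (s : L.Sorts) (x : vars s),
      v s (0, x) = coords g s x ∧ v s (1, x) = coords h s x ∧ v s (2, x) = coords (g * h) s x}

end Struc

end MSLanguage

/-! ### Definable groups, rough measures -/

section RoughMeasures

variable {L : MSLanguage.{u}} {M : L.Struc} {G : Type u} [Group G]

/-- Definable subsets of a definable group. -/
def MSLanguage.Struc.DefinableGroup.IsDefinable (𝔾 : M.DefinableGroup G) (X : Set G) : Prop :=
  M.Definable (𝔾.coords '' X)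

/-- Type-definable subsets: intersections of fewer than `κ` definable subsets. -/
def MSLanguage.Struc.DefinableGroup.IsTypeDefinable (𝔾 : M.DefinableGroup G) (κ : Cardinal.{u})
    (X : Set G) : Prop :=
  ∃ (I : Type u) (D : I → Set G), #I < κ ∧ (∀ i, 𝔾.IsDefinable (D i)) ∧ X = ⋂ i, D i

/-- A subset `X` of a group is symmetric if `1 ∈ X = X⁻¹`. -/
def IsSymmetricSet (X : Set G) : Prop := 1 ∈ X ∧ X⁻¹ = X

/-- `μ` is a `T`-rough measure on the boolean algebra of definable subsets of `G`: an increasing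
subadditive set function that is additive modulo `T`. Only the values of `μ` at definable sets
matter. -/
structure IsRoughMeasure (𝔾 : M.DefinableGroup G) (T : Set G) (μ : Set G → ℝ≥0∞) : Prop where
  mono : ∀ X Y, 𝔾.IsDefinable X → 𝔾.IsDefinable Y → X ⊆ Y → μ X ≤ μ Y
  subadditive : ∀ X Y, 𝔾.IsDefinable X → 𝔾.IsDefinable Y → μ (X ∪ Y) ≤ μ X + μ Y
  additive : ∀ Y Z, 𝔾.IsDefinable Y → 𝔾.IsDefinable Z → Y ∩ (Z * T) = ∅ →
    μ (Y ∪ Z) = μ Y + μ Z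

/-- The value of `μ` at a type-definable set: the infimum over its definable supersets. -/
noncomputable def typeMeasure (𝔾 : M.DefinableGroup G) (μ : Set G → ℝ≥0∞) (Y : Set G) : ℝ≥0∞ :=
  ⨅ (X : Set G) (_ : 𝔾.IsDefinable X) (_ : Y ⊆ X), μ X

/-- `(T i)` is a sequence of definable symmetric subsets of `G` with `T (i + 1) ^ 2 ⊆ T i` and
`a⁻¹ * T (i + 1) * a ⊆ T i` for all `a ∈ A`. -/
structure IsThickeningSequence (𝔾 : M.DefinableGroup G) (A : Set G) (T : ℕ → Set G) : Prop where
  definable : ∀ i, 𝔾.IsDefinable (T i)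
  symmetric : ∀ i, IsSymmetricSet (T i)
  sq_subset : ∀ i, T (i + 1) * T (i + 1) ⊆ T i
  conj_subset : ∀ i, ∀ a ∈ A, ∀ x ∈ T (i + 1), a⁻¹ * x * a ∈ T i

/-- The sequence `μ` witnesses that `A` is `T`-rough definably amenable: each `μ i` is a
`T i`-rough measure on the definable subsets of `G`, invariant under left translations and
normalised at `A`. -/
structure IsRoughAmenabilityWitness (𝔾 : M.DefinableGroup G) (A : Set G) (T : ℕ → Set G)
    (μ : ℕ → Set G → ℝ≥0∞) : Prop where
  rough : ∀ i, IsRoughMeasure 𝔾 (T i) (μ i)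
  invariant : ∀ i, ∀ (g : G) (X : Set G), 𝔾.IsDefinable X → μ i (g • X) = μ i X
  normalised : ∀ i, μ i A = 1

/-- The type-definable subgroup `N` has bounded index in the subgroup `⟨B⟩`, where `B` is a
type-definable symmetric set.

Here `M` is `κ`-saturated for some uncountable `κ`. The index is at most `2 ^ ℵ₀`; if
`κ > 2 ^ ℵ₀` then this says in particular that it is `< κ`. For smaller `κ` a bound on the index in `M` can hold merely because `M` is small (a countable
ultraproduct of countable structures has at most `2 ^ ℵ₀` elements), so it is also required that the index
stays bounded in elementary extensions: each definable superset of `N` covers each of the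
type-definable sets `B ^ n`, whose union is `⟨B⟩`, by finitely many left translates. -/
structure HasBoundedIndex (𝔾 : M.DefinableGroup G) (N : Subgroup G) (B : Set G) : Prop where
  index_le : #(Subgroup.closure B ⧸ N.subgroupOf (Subgroup.closure B)) ≤ 2 ^ ℵ₀
  covers : ∀ D : Set G, 𝔾.IsDefinable D → (N : Set G) ⊆ D → ∀ n : ℕ,
    ∃ F : Set G, F.Finite ∧ F ⊆ Subgroup.closure B ∧ B ^ n ⊆ F * D

end RoughMeasures

/-! The argument finds small sets by an almost-stabiliser method in the style of Sanders and of
Massicot and Wagner. Call a definable symmetric `Z ⊆ A ^ 2` thick if finitely many translates of it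
by elements of `A` cover `A`. The core is `exists_thick_pow_subset`: for thick `Z` and any `m, j`
there is a thick `X` with `X ^ m ⊆ Z ^ 4 * T j`. Heuristically, take `B ⊆ Z` for which the measure
of `P = B * Z` cannot drop by more than a factor `1 - δ` when `B` is replaced by a large
intersection `B ∩ g • B`. Each such `g` almost stabilises `P`, so a product of `m` of them, with `m
* δ < 1`, still moves `P` to a set meeting `P` and lies in `P * P⁻¹ ⊆ Z ^ 4`
(`pow_subset_of_almost_stabilizer`). A pigeonhole argument shows that such `g` abound.

Two corrections are needed. The measures are additive only modulo `T i`, so sets are thickened, and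
each exchange of a thickening with a factor from `A` costs one index. The measures are also not
assumed definable, so "positive measure" is replaced by `IsLarge`, which is first-order
(`DefinablePred.isLarge`), follows from positive measure (`exists_isLarge`), and still yields finite
covers (`IsLarge.exists_finite_cover`).

Passing to elements all of whose `A`-conjugates stay small (`exists_thick_conj`) and iterating
produces a chain `R n = Z n ^ 4 * T (10 * n)` with `R (n + 1) ^ 2 ⊆ R n`, compatible with
conjugation by `A`. Its intersection is `N`. Saturation identifies `⋂ A ^ 4 * T n` with `A ^ 4 * ⋂ T
n`, which gives `N ⊆ A ^ 4 * T`. Finiteness of the measures of all powers comes from covering `A ^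
3` by finitely many translates of `A ^ 2 * T i` and iterating. -/

namespace MSLanguage

/-! ### Renaming of variables and finite support of formulas. -/

section Relabel

variable {L : MSLanguage.{u}}

/-- Rename the variables of a term. -/
def Term.relabel {V W : L.Sorts → Type u} (f : ∀ s, V s → W s) :
    {s : L.Sorts} → L.Term V s → L.Term W s
  | _, .var x => .var (f _ x)
  | _, .app g ts => .app g fun i => (ts i).relabel f

theorem Term.eval_relabel (M : L.Struc) {V W : L.Sorts → Type u} (f : ∀ s, V s → W s)
    (w : M.Assign W) {s : L.Sorts} (t : L.Term V s) :
    (t.relabel f).eval M w = t.eval M (fun s x => w s (f s x)) := by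
  induction t with
  | var x => rfl
  | app g ts ih => simp only [Term.relabel, Term.eval, ih]

/-- Rename the free variables of a formula. -/
def Formula.relabel : {V W : L.Sorts → Type u} → (∀ s, V s → W s) → L.Formula V → L.Formula W
  | _, _, _, .falsum => .falsum
  | _, _, f, .eq a b => .eq (a.relabel f) (b.relabel f)
  | _, _, f, .rel R ts => .rel R fun i => (ts i).relabel f
  | _, _, f, .imp φ ψ => .imp (φ.relabel f) (ψ.relabel f)
  | _, _, f, .all s φ => .all s (φ.relabel fun t => Sum.map (f t) id)

theorem Formula.realize_relabel (M : L.Struc) {V W : L.Sorts → Type u} (φ : L.Formula V)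
    (f : ∀ s, V s → W s) (w : M.Assign W) (v : M.Assign V) (h : ∀ s x, w s (f s x) = v s x) :
    (φ.relabel f).Realize M w ↔ φ.Realize M v := by
  have hv : v = fun s x => w s (f s x) := by
    funext s x
    exact (h s x).symm
  subst hv
  clear h
  induction φ generalizing W with
  | falsum => rfl
  | eq a b => simp only [Formula.relabel, Formula.Realize, Term.eval_relabel]
  | rel R ts => simp only [Formula.relabel, Formula.Realize, Term.eval_relabel]
  | imp φ ψ h₁ h₂ => exact imp_congr (h₁ f w) (h₂ f w)
  | all s φ ih =>
    refine forall_congr' fun a => (ih _ _).trans (iff_of_eq (congrArg _ ?_))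
    funext t x
    rcases x with x | x <;> rfl

/-- The subcontext consisting of the variables in `S`. -/
abbrev subcontext {V : L.Sorts → Type u} (S : Set (Σ s, V s)) : L.Sorts → Type u :=
  fun s => {x : V s // (⟨s, x⟩ : Σ s, V s) ∈ S}

/-- Allowing every larger `S'` lets the supports of several subterms be merged into their union. -/
theorem Term.exists_finite_support {V : L.Sorts → Type u} {s : L.Sorts} (t : L.Term V s) :
    ∃ S : Set (Σ s, V s), S.Finite ∧ ∀ S' : Set (Σ s, V s), S ⊆ S' →
      ∃ t' : L.Term (subcontext S') s, ∀ (M : L.Struc) (v : M.Assign V),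
        t'.eval M (fun _ x => v _ x.1) = t.eval M v := by
  induction t with
  | @var s x => exact ⟨{⟨s, x⟩}, Set.finite_singleton _, fun S' h =>
      ⟨.var ⟨x, h rfl⟩, fun M v => rfl⟩⟩
  | app f ts ih =>
    choose S hS h using ih
    refine ⟨⋃ i, S i, Set.finite_iUnion hS, fun S' hS' => ?_⟩
    choose t' ht' using fun i => h i S' ((Set.subset_iUnion S i).trans hS')
    exact ⟨.app f t', fun M v => by simp only [Term.eval, ht']⟩

theorem Formula.exists_finite_support {V : L.Sorts → Type u} (φ : L.Formula V) :
    ∃ S : Set (Σ s, V s), S.Finite ∧ ∀ S' : Set (Σ s, V s), S ⊆ S' →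
      ∃ φ' : L.Formula (subcontext S'), ∀ (M : L.Struc) (v : M.Assign V),
        φ'.Realize M (fun _ x => v _ x.1) ↔ φ.Realize M v := by
  induction φ with
  | falsum => exact ⟨∅, Set.finite_empty, fun S' _ => ⟨.falsum, fun M v => Iff.rfl⟩⟩
  | eq a b =>
    obtain ⟨S, hS, h⟩ := a.exists_finite_support
    obtain ⟨R, hR, k⟩ := b.exists_finite_support
    refine ⟨S ∪ R, hS.union hR, fun S' hS' => ?_⟩
    obtain ⟨a', ha'⟩ := h S' (Set.subset_union_left.trans hS')
    obtain ⟨b', hb'⟩ := k S' (Set.subset_union_right.trans hS')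
    exact ⟨.eq a' b', fun M v => by simp only [Formula.Realize, ha', hb']⟩
  | rel R ts =>
    choose S hS h using fun i => (ts i).exists_finite_support
    refine ⟨⋃ i, S i, Set.finite_iUnion hS, fun S' hS' => ?_⟩
    choose t' ht' using fun i => h i S' ((Set.subset_iUnion S i).trans hS')
    exact ⟨.rel R t', fun M v => by simp only [Formula.Realize, ht']⟩
  | imp φ ψ h₁ h₂ =>
    obtain ⟨S, hS, h⟩ := h₁
    obtain ⟨R, hR, k⟩ := h₂
    refine ⟨S ∪ R, hS.union hR, fun S' hS' => ?_⟩
    obtain ⟨a', ha'⟩ := h S' (Set.subset_union_left.trans hS')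
    obtain ⟨b', hb'⟩ := k S' (Set.subset_union_right.trans hS')
    exact ⟨.imp a' b', fun M v => by simp only [Formula.Realize, ha', hb']⟩
  | @all V s φ ih =>
    obtain ⟨S, hS, h⟩ := ih
    let j : (Σ t, V t) → Σ t, extend V s t := fun p => ⟨p.1, Sum.inl p.2⟩
    have hj : Function.Injective j := by
      rintro ⟨t, x⟩ ⟨t', x'⟩ e
      obtain ⟨rfl, e⟩ := Sigma.mk.inj_iff.1 e
      obtain rfl := Sum.inl_injective (eq_of_heq e)
      rfl
    refine ⟨j ⁻¹' S, hS.preimage hj.injOn, fun S' hS' => ?_⟩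
    -- This set always contains the bound variable and restricts only the old variables to `S'`.
    obtain ⟨φ', hφ'⟩ := h {p | ∀ x, p.2 = Sum.inl x → (⟨p.1, x⟩ : Σ t, V t) ∈ S'} (by
      rintro ⟨t, y⟩ hy x hx
      have hx : j ⟨t, x⟩ = ⟨t, y⟩ := congrArg (Sigma.mk t) hx.symm
      have hy : j ⟨t, x⟩ ∈ S := hx ▸ hy
      exact hS' hy)
    let g : ∀ t, subcontext {p : Σ t, extend V s t | ∀ x, p.2 = Sum.inl x →
        (⟨p.1, x⟩ : Σ t, V t) ∈ S'} t → extend (subcontext S') s t := fun t y =>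
      match y with
      | ⟨Sum.inl x, hx⟩ => Sum.inl ⟨x, hx x rfl⟩
      | ⟨Sum.inr x, _⟩ => Sum.inr x
    refine ⟨.all s (φ'.relabel g), fun M v => forall_congr' fun a =>
      (Formula.realize_relabel M φ' g _ _ ?_).trans (hφ' M (v.snoc s a))⟩
    rintro t ⟨x | x, hx⟩ <;> rfl

end Relabel

/-! ### Closure properties of definable sets of assignments. -/

namespace Struc

variable {L : MSLanguage.{u}} {M : L.Struc}

theorem DefinableOver.mono {C C' : ∀ s : L.Sorts, Set (M.Carrier s)} (h : ∀ s, C s ⊆ C' s)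
    {V : L.Sorts → Type u} {X : Set (M.Assign V)} (hX : M.DefinableOver C X) :
    M.DefinableOver C' X := by
  obtain ⟨φ, hφ⟩ := hX
  refine ⟨φ.relabel fun s => Sum.map id fun c => ⟨c.1, h s c.2⟩, fun v =>
    (hφ v).trans (Formula.realize_relabel M φ _ _ _ ?_).symm⟩
  rintro s (x | x) <;> rfl

/-- A formula mentions only finitely many parameters. This is what keeps parameter sets small enough
for saturation. -/
theorem Definable.exists_finite {V : L.Sorts → Type u} {X : Set (M.Assign V)}
    (hX : M.Definable X) :
    ∃ C : ∀ s : L.Sorts, Set (M.Carrier s), Finite (Σ s, C s) ∧ M.DefinableOver C X := by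
  obtain ⟨φ, hφ⟩ := hX
  obtain ⟨S, hS, h⟩ := φ.exists_finite_support
  obtain ⟨φ', hφ'⟩ := h S subset_rfl
  let C : ∀ s : L.Sorts, Set (M.Carrier s) := fun s => {c | ⟨s, Sum.inr ⟨c, trivial⟩⟩ ∈ S}
  have := hS.to_subtype
  refine ⟨C, Finite.of_injective (β := S)
    (fun p => ⟨⟨p.1, Sum.inr ⟨p.2.1, trivial⟩⟩, p.2.2⟩) ?_, ?_⟩
  · rintro ⟨s, c, hc⟩ ⟨s', c', hc'⟩ e
    simp only [Subtype.mk.injEq, Sigma.mk.injEq] at e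
    obtain ⟨rfl, e⟩ := e
    obtain rfl := congrArg Subtype.val (Sum.inr_injective (eq_of_heq e))
    rfl
  · let g : ∀ s, subcontext S s → V s ⊕ C s := fun s x =>
      match x with
      | ⟨Sum.inl x, _⟩ => Sum.inl x
      | ⟨Sum.inr c, hc⟩ => Sum.inr ⟨c.1, hc⟩
    refine ⟨φ'.relabel g, fun v =>
      ((Formula.realize_relabel M φ' g _ _ ?_).trans ((hφ' M _).trans (hφ v).symm)).symm⟩
    rintro s ⟨x | x, hx⟩ <;> rfl

theorem definable_empty {V : L.Sorts → Type u} : M.Definable (∅ : Set (M.Assign V)) :=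
  ⟨.falsum, fun _ => Iff.rfl⟩

theorem Definable.himp {V : L.Sorts → Type u} {X Y : Set (M.Assign V)} (hX : M.Definable X)
    (hY : M.Definable Y) : M.Definable {v | v ∈ X → v ∈ Y} := by
  obtain ⟨φ, hφ⟩ := hX
  obtain ⟨ψ, hψ⟩ := hY
  exact ⟨.imp φ ψ, fun v => imp_congr (hφ v) (hψ v)⟩

theorem Definable.compl {V : L.Sorts → Type u} {X : Set (M.Assign V)} (hX : M.Definable X) :
    M.Definable Xᶜ := hX.himp definable_empty

theorem Definable.inter {V : L.Sorts → Type u} {X Y : Set (M.Assign V)} (hX : M.Definable X)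
    (hY : M.Definable Y) : M.Definable (X ∩ Y) := by
  convert (hX.himp hY.compl).compl using 1
  ext v
  simp

theorem definable_univ {V : L.Sorts → Type u} : M.Definable (Set.univ : Set (M.Assign V)) := by
  simpa using (definable_empty (M := M) (V := V)).compl

theorem definable_iInter {V : L.Sorts → Type u} {ι : Type*} [Finite ι] {X : ι → Set (M.Assign V)}
    (hX : ∀ i, M.Definable (X i)) : M.Definable (⋂ i, X i) := by
  have : ∀ s : Set ι, s.Finite → M.Definable (⋂ i ∈ s, X i) := by
    intro s hs
    induction s, hs using Set.Finite.induction_on with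
    | empty => simpa using definable_univ
    | insert _ _ ih => rw [Set.biInter_insert]; exact (hX _).inter ih
  simpa using this Set.univ Set.finite_univ

/-- Substitution of variables and parameters for the variables of a definable set. -/
theorem Definable.subst {V W : L.Sorts → Type u} {X : Set (M.Assign V)} (hX : M.Definable X)
    (e : ∀ s, V s → W s ⊕ M.Carrier s) :
    M.Definable {w : M.Assign W | (fun s x => Sum.elim (w s) id (e s x) : M.Assign V) ∈ X} := by
  obtain ⟨φ, hφ⟩ := hX
  refine ⟨φ.relabel fun s => Sum.elim (fun x => Sum.map id (fun c => ⟨c, trivial⟩) (e s x)) Sum.inr,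
    fun w => (hφ _).trans (Formula.realize_relabel M φ _ _ _ ?_).symm⟩
  rintro s (x | x)
  · simp only [Sum.elim_inl]
    rcases e s x with y | y <;> rfl
  · rfl

theorem Definable.preimage {V W : L.Sorts → Type u} {X : Set (M.Assign V)} (hX : M.Definable X)
    (e : ∀ s, V s → W s) : M.Definable {w : M.Assign W | (fun s x => w s (e s x) : M.Assign V) ∈ X} :=
  hX.subst fun s x => Sum.inl (e s x)

theorem Definable.forall_snoc {V : L.Sorts → Type u} {s : L.Sorts}
    {X : Set (M.Assign (extend V s))} (hX : M.Definable X) :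
    M.Definable {v : M.Assign V | ∀ a, v.snoc s a ∈ X} := by
  obtain ⟨φ, hφ⟩ := hX
  let g : ∀ t, extend V s t ⊕ (Set.univ : Set (M.Carrier t)) →
      extend (fun s => V s ⊕ (Set.univ : Set (M.Carrier s))) s t := fun t =>
    Sum.elim (Sum.map Sum.inl id) (fun c => Sum.inl (Sum.inr c))
  refine ⟨.all s (φ.relabel g), fun v => forall_congr' fun a =>
    (hφ _).trans (Formula.realize_relabel M φ g _ _ ?_).symm⟩
  rintro t ((x | x) | x) <;> rfl

-- The map `e` redirects the coordinate `x` to the new variable of `extend V s`, which is then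
-- quantified. The context remains `V`, so the step can be iterated over finitely many coordinates.
open Classical in
theorem Definable.exists_update {V : L.Sorts → Type u} {X : Set (M.Assign V)}
    (hX : M.Definable X) (s : L.Sorts) (x : V s) :
    M.Definable {v : M.Assign V |
      ∃ v' ∈ X, ∀ t y, (⟨t, y⟩ : Σ s, V s) ≠ ⟨s, x⟩ → v' t y = v t y} := by
  let e : ∀ t, V t → extend V s t := fun t y =>
    if h : (⟨t, y⟩ : Σ s, V s) = ⟨s, x⟩ then Sum.inr ⟨⟨⟩, (Sigma.mk.inj_iff.1 h).1⟩ else Sum.inl y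
  convert (hX.compl.preimage e).forall_snoc.compl using 1
  ext v
  have key : ∀ a : M.Carrier s, (fun t y => (v.snoc s a) t (e t y)) =
      fun t y => if h : (⟨t, y⟩ : Σ s, V s) = ⟨s, x⟩ then
        (Sigma.mk.inj_iff.1 h).1.symm ▸ a else v t y := by
    intro a
    funext t y
    by_cases h : (⟨t, y⟩ : Σ s, V s) = ⟨s, x⟩
    · rw [dif_pos h]
      exact (congrArg (v.snoc s a t) (dif_pos h)).trans rfl
    · rw [dif_neg h]
      exact (congrArg (v.snoc s a t) (dif_neg h)).trans rfl
  refine Iff.trans ?_ (not_forall (p := fun a =>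
    (fun t y => (v.snoc s a) t (e t y) : M.Assign V) ∈ Xᶜ)).symm
  refine Iff.trans ?_ (exists_congr fun a => (Set.notMem_compl_iff (s := X)).symm)
  constructor
  · rintro ⟨v', hv', h⟩
    refine ⟨v' s x, ?_⟩
    have : v' = fun t y => (v.snoc s (v' s x)) t (e t y) := by
      rw [key]
      funext t y
      split_ifs with hh
      · obtain ⟨rfl, hh⟩ := Sigma.mk.inj_iff.1 hh
        obtain rfl := eq_of_heq hh
        rfl
      · exact h t y hh
    exact this ▸ hv'
  · rintro ⟨a, ha⟩
    refine ⟨_, ha, fun t y h => ?_⟩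
    exact (congrFun (congrFun (key a) t) y).trans (dif_neg h)

theorem Definable.exists_agree_off {V : L.Sorts → Type u} (F : Set (Σ s, V s)) (hF : F.Finite)
    {X : Set (M.Assign V)} (hX : M.Definable X) :
    M.Definable {v : M.Assign V | ∃ v' ∈ X, ∀ t y, (⟨t, y⟩ : Σ s, V s) ∉ F → v' t y = v t y} := by
  classical
  induction F, hF using Set.Finite.induction_on with
  | empty =>
    convert hX using 1
    ext v
    constructor
    · rintro ⟨v', hv', h⟩
      have : v' = v := by funext t y; exact h t y (by simp)
      exact this ▸ hv'
    · exact fun h => ⟨v, h, fun _ _ _ => rfl⟩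
  | @insert p F _ _ ih =>
    obtain ⟨s, x⟩ := p
    convert ih.exists_update s x using 1
    ext v
    constructor
    · rintro ⟨v', hv', h⟩
      refine ⟨fun t y => if (⟨t, y⟩ : Σ s, V s) ∈ F then v t y else v' t y, ⟨v', hv', ?_⟩, ?_⟩
      · intro t y hy
        simp [hy]
      · intro t y hy
        by_cases hF : (⟨t, y⟩ : Σ s, V s) ∈ F
        · simp [hF]
        · simp [hF, h t y (not_or.2 ⟨hy, hF⟩)]
    · rintro ⟨v₁, ⟨v', hv', h₁⟩, h⟩
      exact ⟨v', hv', fun t y hy => (h₁ t y fun hF => hy (Or.inr hF)).trans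
        (h t y fun hF => hy (Or.inl hF))⟩

end Struc

end MSLanguage

/-- Iterated largeness of a subset `B` of a group: a set is `[]`-large if it is nonempty, and
`N :: l`-large if among any `N` elements of `A` there are two, `a i` and `a j`, for which the
intersection of `B` with the translate of `B * U` by `(a j)⁻¹ * a i` is `l`-large. -/
def IsLarge {G : Type*} [Group G] (A U : Set G) : List ℕ → Set G → Prop
  | [], B => B.Nonempty
  | N :: l, B => ∀ a : Fin N → G, (∀ i, a i ∈ A) →
      ∃ i j, i < j ∧ IsLarge A U l (B ∩ ((a j)⁻¹ * a i) • (B * U))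

/-! ### Definable relations and functions on a definable group. -/

namespace MSLanguage.Struc.DefinableGroup

variable {L : MSLanguage.{u}} {M : L.Struc} {G : Type u} [Group G] (𝔾 : M.DefinableGroup G)

/-- The coordinates of a family of elements of a definable group. -/
def tuple {ι : Type} (g : ι → G) : M.Assign (fun s => ι × 𝔾.vars s) :=
  fun s p => 𝔾.coords (g p.1) s p.2

/-- Definable relations on a definable group. -/
def DefinablePred {ι : Type} (P : (ι → G) → Prop) : Prop :=
  ∃ X : Set (M.Assign fun s => ι × 𝔾.vars s), M.Definable X ∧ ∀ g, P g ↔ 𝔾.tuple g ∈ X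

/-- Definable functions on powers of a definable group. -/
def DefinableFun {ι : Type} (t : (ι → G) → G) : Prop :=
  𝔾.DefinablePred (ι := Unit ⊕ ι) fun g => g (Sum.inl ()) = t fun i => g (Sum.inr i)

variable {𝔾}

section

variable {ι κ : Type}

theorem DefinablePred.congr {P Q : (ι → G) → Prop} (hP : 𝔾.DefinablePred P)
    (h : ∀ g, Q g ↔ P g) : 𝔾.DefinablePred Q := by
  obtain ⟨X, hX, hP⟩ := hP
  exact ⟨X, hX, fun g => (h g).trans (hP g)⟩

theorem DefinablePred.not {P : (ι → G) → Prop} (hP : 𝔾.DefinablePred P) :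
    𝔾.DefinablePred fun g => ¬ P g := by
  obtain ⟨X, hX, hP⟩ := hP
  exact ⟨Xᶜ, hX.compl, fun g => not_congr (hP g)⟩

theorem DefinablePred.and {P Q : (ι → G) → Prop} (hP : 𝔾.DefinablePred P)
    (hQ : 𝔾.DefinablePred Q) : 𝔾.DefinablePred fun g => P g ∧ Q g := by
  obtain ⟨X, hX, hP⟩ := hP
  obtain ⟨Y, hY, hQ⟩ := hQ
  exact ⟨X ∩ Y, hX.inter hY, fun g => and_congr (hP g) (hQ g)⟩

theorem DefinablePred.imp {P Q : (ι → G) → Prop} (hP : 𝔾.DefinablePred P)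
    (hQ : 𝔾.DefinablePred Q) : 𝔾.DefinablePred fun g => P g → Q g :=
  (hP.and hQ.not).not.congr fun g => by tauto

theorem DefinablePred.forall_finite [Finite κ] {P : κ → (ι → G) → Prop}
    (hP : ∀ k, 𝔾.DefinablePred (P k)) : 𝔾.DefinablePred fun g => ∀ k, P k g := by
  choose X hX hP using hP
  exact ⟨⋂ k, X k, definable_iInter hX, fun g =>
    (forall_congr' fun k => hP k g).trans Set.mem_iInter.symm⟩

theorem DefinablePred.exists_finite [Finite κ] {P : κ → (ι → G) → Prop}
    (hP : ∀ k, 𝔾.DefinablePred (P k)) : 𝔾.DefinablePred fun g => ∃ k, P k g :=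
  (DefinablePred.forall_finite fun k => (hP k).not).not.congr fun g => by simp

/-- Substitution of variables and constants in a definable relation. -/
theorem DefinablePred.subst {P : (κ → G) → Prop} (hP : 𝔾.DefinablePred P) (e : κ → ι ⊕ G) :
    𝔾.DefinablePred fun g : ι → G => P fun k => Sum.elim g id (e k) := by
  obtain ⟨X, hX, hP⟩ := hP
  refine ⟨_, hX.subst fun s p => Sum.map (fun i => (i, p.2)) (fun c => 𝔾.coords c s p.2) (e p.1),
    fun g => (hP _).trans (iff_of_eq (congrArg (· ∈ X) ?_))⟩
  funext s p
  change 𝔾.coords (Sum.elim g id (e p.1)) s p.2 = _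
  rcases e p.1 with i | c <;> rfl

theorem DefinablePred.comap {P : (κ → G) → Prop} (hP : 𝔾.DefinablePred P) (e : κ → ι) :
    𝔾.DefinablePred fun g : ι → G => P fun k => g (e k) :=
  hP.subst fun k => Sum.inl (e k)

/-- The context is kept fixed: the coordinates at `κ` are freed by `exists_agree_off`, and the
resulting dummy variables are filled with `1` at the end. A set witnessing `DefinablePred` is
unconstrained off tuples from `G`, so `hR` is needed to force the freed coordinates back into `G`.
-/
theorem DefinablePred.exists_elim [Finite κ] {P : (κ ⊕ ι → G) → Prop}
    (hP : 𝔾.DefinablePred P) : 𝔾.DefinablePred fun g : ι → G => ∃ h : κ → G, P (Sum.elim h g) := by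
  have hQ : 𝔾.DefinablePred fun g : κ ⊕ ι → G =>
      ∃ h : κ → G, P (Sum.elim h fun i => g (Sum.inr i)) := by
    obtain ⟨X, hX, hP⟩ := hP
    have := 𝔾.finite_vars
    let F : Set (Σ s, (κ ⊕ ι) × 𝔾.vars s) :=
      Set.range fun p : κ × Σ s, 𝔾.vars s => ⟨p.2.1, Sum.inl p.1, p.2.2⟩
    have hR := definable_iInter fun k : κ =>
      𝔾.definable_range.preimage (W := fun s => (κ ⊕ ι) × 𝔾.vars s) fun s x => (Sum.inl k, x)
    refine ⟨_, (hX.inter hR).exists_agree_off F (Set.finite_range _), fun g => ⟨?_, ?_⟩⟩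
    · rintro ⟨h, hh⟩
      refine ⟨_, ⟨(hP _).1 hh, Set.mem_iInter.2 fun k => ⟨h k, rfl⟩⟩, ?_⟩
      rintro s ⟨k | i, x⟩ hx
      · exact (hx ⟨(k, ⟨s, x⟩), rfl⟩).elim
      · rfl
    · rintro ⟨v, ⟨hv, hvR⟩, hvg⟩
      choose h hh using fun k => Set.mem_iInter.1 hvR k
      refine ⟨h, (hP _).2 ?_⟩
      have : 𝔾.tuple (Sum.elim h fun i => g (Sum.inr i)) = v := by
        funext s p
        rcases p with ⟨k | i, x⟩
        · exact congrFun (congrFun (hh k) s) x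
        · refine (hvg s (Sum.inr i, x) ?_).symm
          rintro ⟨⟨k, t, y⟩, e⟩
          obtain ⟨rfl, e⟩ := Sigma.mk.inj_iff.1 e
          simpa using congrArg Prod.fst (eq_of_heq e)
      exact this ▸ hv
  exact hQ.subst (Sum.elim (fun _ => Sum.inr 1) Sum.inl)

theorem DefinablePred.exists {P : (Unit ⊕ ι → G) → Prop} (hP : 𝔾.DefinablePred P) :
    𝔾.DefinablePred fun g : ι → G => ∃ x : G, P (Sum.elim (fun _ => x) g) :=
  hP.exists_elim.congr fun _ =>
    ⟨fun ⟨x, hx⟩ => ⟨fun _ => x, hx⟩, fun ⟨h, hh⟩ => ⟨h (), hh⟩⟩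

theorem DefinablePred.forall {P : (Unit ⊕ ι → G) → Prop} (hP : 𝔾.DefinablePred P) :
    𝔾.DefinablePred fun g : ι → G => ∀ x : G, P (Sum.elim (fun _ => x) g) :=
  hP.not.exists.not.congr fun g => by simp

theorem definablePred_mul : 𝔾.DefinablePred fun g : Fin 3 → G => g 0 * g 1 = g 2 := by
  refine ⟨_, 𝔾.definable_mul, fun g => ⟨fun h => ⟨g 0, g 1, fun s x => ⟨rfl, rfl, ?_⟩⟩, ?_⟩⟩
  · rw [h]
    rfl
  · rintro ⟨a, b, h⟩
    have h0 : g 0 = a := 𝔾.coords_injective (by funext s x; exact (h s x).1)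
    have h1 : g 1 = b := 𝔾.coords_injective (by funext s x; exact (h s x).2.1)
    have h2 : g 2 = a * b := 𝔾.coords_injective (by funext s x; exact (h s x).2.2)
    rw [h0, h1, h2]

theorem definablePred_eq : 𝔾.DefinablePred fun g : Fin 2 → G => g 0 = g 1 :=
  (definablePred_mul.subst ![Sum.inl 0, Sum.inr 1, Sum.inl 1]).congr fun g => by simp

theorem definableFun_var (i : ι) : 𝔾.DefinableFun fun g : ι → G => g i :=
  (definablePred_eq.subst ![Sum.inl (Sum.inl ()), Sum.inl (Sum.inr i)]).congr fun g => by simp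

theorem definableFun_const (c : G) : 𝔾.DefinableFun fun _ : ι → G => c :=
  (definablePred_eq.subst ![Sum.inl (Sum.inl ()), Sum.inr c]).congr fun g => by simp

theorem DefinableFun.comap {t : (κ → G) → G} (ht : 𝔾.DefinableFun t) (e : κ → ι) :
    𝔾.DefinableFun fun g : ι → G => t fun k => g (e k) :=
  (DefinablePred.comap ht (Sum.map id e) : _)

theorem DefinablePred.comp [Finite κ] {P : (κ → G) → Prop} (hP : 𝔾.DefinablePred P)
    {t : κ → (ι → G) → G} (ht : ∀ k, 𝔾.DefinableFun (t k)) :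
    𝔾.DefinablePred fun g => P fun k => t k g := by
  have h₁ : 𝔾.DefinablePred fun g : κ ⊕ ι → G =>
      ∀ k, g (Sum.inl k) = t k fun i => g (Sum.inr i) :=
    DefinablePred.forall_finite fun k =>
      DefinablePred.comap (ht k) (Sum.elim (fun _ => Sum.inl k) Sum.inr)
  refine (h₁.and (hP.comap Sum.inl)).exists_elim.congr fun g =>
    ⟨fun h => ⟨_, fun _ => rfl, h⟩, ?_⟩
  rintro ⟨h, h₁, h₂⟩
  have : h = fun k => t k g := funext h₁
  exact this ▸ h₂

theorem DefinableFun.comp [Finite κ] {f : (κ → G) → G} (hf : 𝔾.DefinableFun f)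
    {t : κ → (ι → G) → G} (ht : ∀ k, 𝔾.DefinableFun (t k)) :
    𝔾.DefinableFun fun g => f fun k => t k g :=
  DefinablePred.comp (ι := Unit ⊕ ι) (t := Sum.elim (fun _ g => g (Sum.inl ()))
      fun k g => t k fun i => g (Sum.inr i)) hf <| by
    rintro (_ | k)
    · exact definableFun_var _
    · exact (ht k).comap Sum.inr

theorem DefinableFun.mul {t₁ t₂ : (ι → G) → G} (h₁ : 𝔾.DefinableFun t₁)
    (h₂ : 𝔾.DefinableFun t₂) : 𝔾.DefinableFun fun g => t₁ g * t₂ g := by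
  have h : 𝔾.DefinableFun fun g : Fin 2 → G => g 0 * g 1 :=
    (definablePred_mul.comap ![Sum.inr 0, Sum.inr 1, Sum.inl ()]).congr fun g => eq_comm
  refine h.comp (t := ![t₁, t₂]) fun k => ?_
  fin_cases k
  · exact h₁
  · exact h₂

theorem DefinableFun.inv {t : (ι → G) → G} (ht : 𝔾.DefinableFun t) :
    𝔾.DefinableFun fun g => (t g)⁻¹ := by
  have h : 𝔾.DefinableFun fun g : Unit → G => (g ())⁻¹ :=
    (definablePred_mul.subst ![Sum.inl (Sum.inl ()), Sum.inl (Sum.inr ()), Sum.inr 1]).congr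
      fun g => by simp [mul_eq_one_iff_eq_inv]
  exact h.comp fun _ => ht

theorem isDefinable_iff {Y : Set G} :
    𝔾.IsDefinable Y ↔ 𝔾.DefinablePred fun g : Unit → G => g () ∈ Y := by
  constructor
  · intro h
    refine ⟨_, h.preimage (W := fun s => Unit × 𝔾.vars s) fun s x => ((), x), fun g =>
      ⟨fun hg => ⟨_, hg, rfl⟩, ?_⟩⟩
    rintro ⟨y, hy, e⟩
    obtain rfl : y = g () := 𝔾.coords_injective e
    exact hy
  · rintro ⟨X, hX, h⟩
    have := 𝔾.definable_range.inter (hX.preimage (W := 𝔾.vars) fun s p => p.2)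
    refine (congrArg M.Definable ?_).mp this
    ext v
    constructor
    · rintro ⟨⟨y, rfl⟩, hy⟩
      exact ⟨y, (h fun _ => y).2 hy, rfl⟩
    · rintro ⟨y, hy, rfl⟩
      exact ⟨⟨y, rfl⟩, (h fun _ => y).1 hy⟩

theorem IsDefinable.mem {Y : Set G} (hY : 𝔾.IsDefinable Y) {t : (ι → G) → G}
    (ht : 𝔾.DefinableFun t) : 𝔾.DefinablePred fun g => t g ∈ Y :=
  (isDefinable_iff.1 hY).comp fun _ => ht

end

section

variable {X Y : Set G}

theorem IsDefinable.compl (hX : 𝔾.IsDefinable X) : 𝔾.IsDefinable Xᶜ :=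
  isDefinable_iff.2 (isDefinable_iff.1 hX).not

theorem IsDefinable.inter (hX : 𝔾.IsDefinable X) (hY : 𝔾.IsDefinable Y) :
    𝔾.IsDefinable (X ∩ Y) :=
  isDefinable_iff.2 ((isDefinable_iff.1 hX).and (isDefinable_iff.1 hY))

theorem IsDefinable.union (hX : 𝔾.IsDefinable X) (hY : 𝔾.IsDefinable Y) :
    𝔾.IsDefinable (X ∪ Y) := by
  simpa [Set.compl_inter] using (hX.compl.inter hY.compl).compl

theorem IsDefinable.diff (hX : 𝔾.IsDefinable X) (hY : 𝔾.IsDefinable Y) :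
    𝔾.IsDefinable (X \ Y) := hX.inter hY.compl

theorem isDefinable_empty : 𝔾.IsDefinable (∅ : Set G) := by
  simpa [IsDefinable] using definable_empty

theorem isDefinable_singleton (c : G) : 𝔾.IsDefinable {c} :=
  isDefinable_iff.2 (DefinablePred.congr
    (definablePred_eq.subst ![Sum.inl (), Sum.inr c]) fun g => by simp)

theorem IsDefinable.inv (hX : 𝔾.IsDefinable X) : 𝔾.IsDefinable X⁻¹ :=
  isDefinable_iff.2 (hX.mem (definableFun_var ()).inv)

theorem IsDefinable.smul (hX : 𝔾.IsDefinable X) (g : G) : 𝔾.IsDefinable (g • X) :=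
  isDefinable_iff.2 ((hX.mem ((definableFun_const g⁻¹).mul (definableFun_var ()))).congr
    fun _ => Set.mem_smul_set_iff_inv_smul_mem)

theorem IsDefinable.mul (hX : 𝔾.IsDefinable X) (hY : 𝔾.IsDefinable Y) :
    𝔾.IsDefinable (X * Y) := by
  refine isDefinable_iff.2 (DefinablePred.congr ((hX.mem (definableFun_var (Sum.inl ()))).and
    (hY.mem ((definableFun_var (Sum.inl ())).inv.mul
      (definableFun_var (Sum.inr ()))))).exists fun g => ?_)
  simp only [Sum.elim_inl, Sum.elim_inr, Set.mem_mul]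
  constructor
  · rintro ⟨x, hx, y, hy, e⟩
    exact ⟨x, hx, by simpa [← e] using hy⟩
  · rintro ⟨x, hx, hy⟩
    exact ⟨x, hx, _, hy, by simp⟩

theorem IsDefinable.pow (hX : 𝔾.IsDefinable X) (n : ℕ) : 𝔾.IsDefinable (X ^ n) := by
  induction n with
  | zero => exact isDefinable_singleton 1
  | succ n ih => rw [pow_succ]; exact ih.mul hX

theorem IsDefinable.finite_mul {F : Set G} (hF : F.Finite) (hX : 𝔾.IsDefinable X) :
    𝔾.IsDefinable (F * X) := by
  induction F, hF using Set.Finite.induction_on with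
  | empty => simpa using isDefinable_empty
  | insert _ _ ih =>
    rw [Set.insert_eq, Set.union_mul, Set.singleton_mul]
    exact (hX.smul _).union ih

theorem IsDefinable.forall_conj_mem (hX : 𝔾.IsDefinable X) (hY : 𝔾.IsDefinable Y) :
    𝔾.IsDefinable {z | ∀ a ∈ X, a⁻¹ * z * a ∈ Y} :=
  isDefinable_iff.2 ((hX.mem (definableFun_var (Sum.inl ()))).imp
    (hY.mem (((definableFun_var (Sum.inl ())).inv.mul (definableFun_var (Sum.inr ()))).mul
      (definableFun_var (Sum.inl ()))))).forall

end

/-! ### Definability of iterated largeness. -/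

section

variable {A U : Set G}

/-- The induction runs over all `ι` and `P` at once, because unfolding one entry of `l` adds the `N`
translating elements to the free variables. -/
theorem DefinablePred.isLarge (hA : 𝔾.IsDefinable A) (hU : 𝔾.IsDefinable U) (l : List ℕ)
    {ι : Type} {P : (Unit ⊕ ι → G) → Prop} (hP : 𝔾.DefinablePred P) :
    𝔾.DefinablePred fun g : ι → G => IsLarge A U l {x | P (Sum.elim (fun _ => x) g)} := by
  induction l generalizing ι with
  | nil => exact hP.exists
  | cons N l ih =>
    have h₁ : ∀ i j : Fin N, 𝔾.DefinablePred fun g : Fin N ⊕ ι → G =>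
        IsLarge A U l ({x | P (Sum.elim (fun _ => x) fun k => g (Sum.inr k))} ∩
          ((g (Sum.inl j))⁻¹ * g (Sum.inl i)) •
            ({x | P (Sum.elim (fun _ => x) fun k => g (Sum.inr k))} * U)) := by
      intro i j
      have hx : 𝔾.DefinablePred fun g : Unit ⊕ (Fin N ⊕ ι) → G =>
          P (Sum.elim (fun _ => g (Sum.inl ())) fun k => g (Sum.inr (Sum.inr k))) :=
        (hP.comap (Sum.elim Sum.inl fun k => Sum.inr (Sum.inr k))).congr fun g =>
          iff_of_eq (congrArg P (by funext k; rcases k with k | k <;> rfl))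
      have hy : 𝔾.DefinablePred fun g : Unit ⊕ (Unit ⊕ (Fin N ⊕ ι)) → G =>
          P (Sum.elim (fun _ => g (Sum.inl ())) fun k => g (Sum.inr (Sum.inr (Sum.inr k)))) :=
        (hP.comap (Sum.elim Sum.inl fun k => Sum.inr (Sum.inr (Sum.inr k)))).congr fun g =>
          iff_of_eq (congrArg P (by funext k; rcases k with k | k <;> rfl))
      have hz := (hy.and (hU.mem ((definableFun_var (Sum.inl ())).inv.mul
        (((definableFun_var (Sum.inr (Sum.inr (Sum.inl i)))).inv.mul
          (definableFun_var (Sum.inr (Sum.inr (Sum.inl j))))).mul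
            (definableFun_var (Sum.inr (Sum.inl ()))))))).exists
      refine (ih (hx.and hz)).congr fun g => iff_of_eq (congrArg _ ?_)
      ext x
      simp only [Set.mem_inter_iff, Set.mem_ofPred_eq, Sum.elim_inl, Sum.elim_inr,
        Set.mem_smul_set_iff_inv_smul_mem, Set.mem_mul, smul_eq_mul, mul_inv_rev, inv_inv]
      refine and_congr Iff.rfl ⟨?_, ?_⟩
      · rintro ⟨y, hy, z, hz, e⟩
        exact ⟨y, hy, by simpa [← e] using hz⟩
      · rintro ⟨y, hy, hz⟩
        exact ⟨y, hy, _, hz, by simp⟩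
    have h₂ : 𝔾.DefinablePred fun g : Fin N ⊕ ι → G => ∀ i : Fin N, g (Sum.inl i) ∈ A :=
      DefinablePred.forall_finite fun i => hA.mem (definableFun_var _)
    have h₃ := DefinablePred.exists_finite fun p : {p : Fin N × Fin N // p.1 < p.2} =>
      h₁ p.1.1 p.1.2
    refine (h₂.imp h₃).not.exists_elim.not.congr fun g => ?_
    simp only [not_exists, not_not]
    refine forall_congr' fun a => imp_congr Iff.rfl ⟨?_, ?_⟩
    · rintro ⟨i, j, hij, h⟩
      exact ⟨⟨(i, j), hij⟩, h⟩
    · rintro ⟨⟨⟨i, j⟩, hij⟩, h⟩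
      exact ⟨i, j, hij, h⟩

theorem IsDefinable.isLarge_inter_smul (hA : 𝔾.IsDefinable A) (hU : 𝔾.IsDefinable U)
    (l : List ℕ) {X Y : Set G} (hX : 𝔾.IsDefinable X) (hY : 𝔾.IsDefinable Y) :
    𝔾.IsDefinable {g | IsLarge A U l (X ∩ g • Y)} := by
  have h := (hX.mem (definableFun_var (ι := Unit ⊕ Unit) (Sum.inl ()))).and
    (hY.mem ((definableFun_var (Sum.inr ())).inv.mul (definableFun_var (Sum.inl ()))))
  refine isDefinable_iff.2 ((h.isLarge hA hU l).congr fun g =>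
    iff_of_eq (congrArg (IsLarge A U l) ?_))
  ext x
  simp [Set.mem_smul_set_iff_inv_smul_mem]

end

/-! ### Compactness for countable chains of definable sets. -/

section Saturation

variable {κ : Cardinal.{u}}

/-- Each `X n` needs finitely many parameters, so the chain needs countably many, fewer than `κ`.
Monotonicity reduces finite satisfiability to a single `X n`. -/
theorem iInter_nonempty_of_saturated (hκ : ℵ₀ < κ) (hM : M.Saturated κ) {X : ℕ → Set G}
    (hX : ∀ n, 𝔾.IsDefinable (X n)) (hanti : Antitone X) (hne : ∀ n, (X n).Nonempty) :
    (⋂ n, X n).Nonempty := by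
  choose C hC hCX using fun n => Definable.exists_finite (hX n)
  have hcount : #(Σ s, (⋃ n, C n s : Set (M.Carrier s))) < κ := by
    refine lt_of_le_of_lt (Cardinal.mk_le_aleph0_iff.2 ?_) hκ
    have : ∀ n, Countable (Σ s, C n s) := fun n => Finite.to_countable
    refine Function.Surjective.countable (α := Σ n, Σ s, C n s)
      (f := fun p => ⟨p.2.1, p.2.2.1, Set.mem_iUnion.2 ⟨p.1, p.2.2.2⟩⟩) ?_
    rintro ⟨s, c, hc⟩
    obtain ⟨n, hn⟩ := Set.mem_iUnion.1 hc
    exact ⟨⟨n, s, c, hn⟩, rfl⟩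
  obtain ⟨v, hv⟩ := hM (fun s => ⋃ n, C n s) hcount 𝔾.vars 𝔾.finite_vars
    (Set.range fun n => 𝔾.coords '' X n)
    (by
      rintro _ ⟨n, rfl⟩
      exact (hCX n).mono fun s => Set.subset_iUnion (fun n => C n s) n)
    (by
      intro F hF hfin
      obtain ⟨n, hn⟩ : ∃ n, ∀ Y ∈ F, 𝔾.coords '' X n ⊆ Y := by
        choose! m hm using hF
        obtain ⟨n, hn⟩ := (hfin.image m).bddAbove
        refine ⟨n, fun Y hY => ?_⟩
        rw [← hm hY]
        exact Set.image_mono (hanti (hn ⟨Y, hY, rfl⟩))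
      exact ((hne n).image _).mono (Set.subset_sInter hn))
  obtain ⟨g, -, rfl⟩ := hv _ ⟨0, rfl⟩
  refine ⟨g, Set.mem_iInter.2 fun n => ?_⟩
  obtain ⟨h, hh, e⟩ := hv _ ⟨n, rfl⟩
  exact 𝔾.coords_injective e ▸ hh

theorem exists_subset_of_iInter_subset (hκ : ℵ₀ < κ) (hM : M.Saturated κ) {X : ℕ → Set G}
    (hX : ∀ n, 𝔾.IsDefinable (X n)) (hanti : Antitone X) {D : Set G} (hD : 𝔾.IsDefinable D)
    (h : ⋂ n, X n ⊆ D) : ∃ n, X n ⊆ D := by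
  by_contra! hcon
  obtain ⟨g, hg⟩ := iInter_nonempty_of_saturated hκ hM (fun n => (hX n).diff hD)
    (fun m n hmn => Set.sdiff_subset_sdiff_left (hanti hmn))
    (fun n => Set.sdiff_nonempty.2 (hcon n))
  rw [Set.mem_iInter] at hg
  exact (hg 0).2 (h (Set.mem_iInter.2 fun n => (hg n).1))

/-- For `g` in every `D * X n`, the elements `d ∈ D` with `d⁻¹ * g ∈ X n` form a decreasing chain of
nonempty definable sets. Compactness gives one `d` for all `n`. -/
theorem iInter_mul_eq (hκ : ℵ₀ < κ) (hM : M.Saturated κ) {X : ℕ → Set G}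
    (hX : ∀ n, 𝔾.IsDefinable (X n)) (hanti : Antitone X) {D : Set G} (hD : 𝔾.IsDefinable D) :
    ⋂ n, D * X n = D * ⋂ n, X n := by
  refine Set.Subset.antisymm (fun g hg => ?_) (Set.mul_iInter_subset _ _)
  obtain ⟨d, hd⟩ := iInter_nonempty_of_saturated (𝔾 := 𝔾) hκ hM
    (X := fun n => D ∩ g • (X n)⁻¹) (fun n => hD.inter ((hX n).inv.smul g))
    (fun m n hmn => Set.inter_subset_inter_right _ (Set.smul_set_mono (Set.inv_subset_inv.2
      (hanti hmn)))) fun n => by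
      obtain ⟨d, hd, x, hx, rfl⟩ := Set.mem_iInter.1 hg n
      exact ⟨d, hd, Set.mem_smul_set_iff_inv_smul_mem.2 (by simpa using hx)⟩
  rw [Set.mem_iInter] at hd
  refine ⟨d, (hd 0).1, d⁻¹ * g, Set.mem_iInter.2 fun n => ?_, by simp⟩
  simpa using Set.mem_smul_set_iff_inv_smul_mem.1 (hd n).2

end Saturation

end MSLanguage.Struc.DefinableGroup

theorem Set.insert_mul_eq_smul_union {G : Type*} [Group G] (g : G) (F X : Set G) :
    insert g F * X = g • X ∪ F * X := by
  rw [Set.insert_eq, Set.union_mul, Set.singleton_mul]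
  rfl

/-! ### Covering and pigeonhole arguments for invariant rough measures. -/

section InvariantRoughMeasure

variable {L : MSLanguage.{u}} {M : L.Struc} {G : Type u} [Group G]

/-- Left-invariant rough measures that vanish at the empty set. -/
structure IsInvariantRoughMeasure (𝔾 : M.DefinableGroup G) (U : Set G) (μ : Set G → ℝ≥0∞) : Prop
    extends IsRoughMeasure 𝔾 U μ where
  smul : ∀ (g : G) (X : Set G), 𝔾.IsDefinable X → μ (g • X) = μ X
  empty : μ ∅ = 0

namespace IsInvariantRoughMeasure

open MSLanguage.Struc.DefinableGroup

variable {𝔾 : M.DefinableGroup G} {U : Set G} {μ : Set G → ℝ≥0∞}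

theorem finite_mul_le (h : IsInvariantRoughMeasure 𝔾 U μ) {F X : Set G} (hF : F.Finite)
    (hX : 𝔾.IsDefinable X) : μ (F * X) ≤ F.ncard * μ X := by
  induction F, hF using Set.Finite.induction_on with
  | empty => simp [h.empty]
  | @insert g F hg hF ih =>
    rw [Set.insert_mul_eq_smul_union,
      Set.ncard_insert_of_notMem hg hF]
    calc μ (g • X ∪ F * X) ≤ μ (g • X) + μ (F * X) :=
          h.subadditive _ _ (hX.smul g) (.finite_mul hF hX)
      _ ≤ μ X + F.ncard * μ X := by rw [h.smul g X hX]; gcongr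
      _ = _ := by push_cast; ring

theorem finite_mul_ne_top (h : IsInvariantRoughMeasure 𝔾 U μ) {F X : Set G} (hF : F.Finite)
    (hX : 𝔾.IsDefinable X) (hfin : μ X ≠ ∞) : μ (F * X) ≠ ∞ :=
  ne_top_of_le_ne_top (ENNReal.mul_ne_top (by simp) hfin) (h.finite_mul_le hF hX)

/-- If the translates of a set of positive measure by elements of `H` lie in a set of finite
measure, then finitely many translates of `Z * U * Z⁻¹` cover `H`. -/
theorem exists_finite_cover (h : IsInvariantRoughMeasure 𝔾 U μ) {H Z D : Set G}
    (hZ : 𝔾.IsDefinable Z) (hD : 𝔾.IsDefinable D) (hpos : μ Z ≠ 0) (hHZ : H * Z ⊆ D)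
    (hfin : μ D ≠ ∞) : ∃ F ⊆ H, F.Finite ∧ H ⊆ F * (Z * U * Z⁻¹) := by
  -- Otherwise a greedy choice never stops: each new `g` lies outside `F * (Z * U * Z⁻¹)`, so `g •
  -- Z` misses `F * Z * U` and the measures add up.
  by_contra! hcon
  have key : ∀ n : ℕ, ∃ F ⊆ H, F.Finite ∧ n * μ Z ≤ μ (F * Z) := by
    intro n
    induction n with
    | zero => exact ⟨∅, Set.empty_subset _, Set.finite_empty, by simp⟩
    | succ n ih =>
      obtain ⟨F, hFH, hF, hn⟩ := ih
      obtain ⟨g, hg, hgF⟩ := Set.not_subset.1 (hcon F hFH hF)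
      refine ⟨insert g F, Set.insert_subset hg hFH, hF.insert g, ?_⟩
      rw [Set.insert_mul_eq_smul_union, h.additive _ _ (hZ.smul g)
        (.finite_mul hF hZ), h.smul g Z hZ]
      · push_cast
        rw [add_mul, one_mul, add_comm]
        gcongr
      · refine Set.eq_empty_iff_forall_notMem.2 ?_
        rintro _ ⟨⟨z, hz, rfl⟩, _, ⟨f, hf, z', hz', rfl⟩, u, hu, e⟩
        refine hgF ⟨f, hf, z' * u * z⁻¹, ⟨z' * u, ⟨z', hz', u, hu, rfl⟩, z⁻¹, by simpa, rfl⟩, ?_⟩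
        simp only [smul_eq_mul] at e ⊢
        rw [eq_mul_inv_of_mul_eq e.symm]
        group
  obtain ⟨n, hn⟩ := ENNReal.exists_nat_mul_gt hpos hfin
  obtain ⟨F, hFH, hF, h'⟩ := key n
  exact absurd (hn.trans_le (h'.trans (h.mono _ _ (.finite_mul hF hZ) hD
    ((Set.mul_subset_mul_right hFH).trans hHZ)))) (lt_irrefl _)

/-- Among sufficiently many translates of a set of measure at least `t`, inside a set of finite
measure, there are two with a large approximate intersection. -/
theorem exists_large_inter (h : IsInvariantRoughMeasure 𝔾 U μ) (hU : 𝔾.IsDefinable U)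
    {H Z D : Set G} (hD : 𝔾.IsDefinable D) (hHZ : H * Z ⊆ D) (hfin : μ D ≠ ∞) {t : ℝ≥0∞}
    (ht : t ≠ 0) : ∃ N : ℕ, ∃ t' ≠ (0 : ℝ≥0∞), ∀ B ⊆ Z, 𝔾.IsDefinable B → t ≤ μ B →
      ∀ a : Fin N → G, (∀ i, a i ∈ H) →
        ∃ i j, i < j ∧ t' ≤ μ (B ∩ ((a j)⁻¹ * a i) • (B * U)) := by
  -- If all approximate intersections had measure below `1 / N ^ 2`, then `N` translates would lose
  -- at most `1` in total through overlaps. Their union would have measure at least `N * t - 1 > μ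
  -- D`.
  obtain ⟨N, hN⟩ := ENNReal.exists_nat_mul_gt ht (ENNReal.add_ne_top.2 ⟨hfin, ENNReal.one_ne_top⟩)
  have hN0 : (N : ℝ≥0∞) ≠ 0 := by
    rintro h0
    simp [h0] at hN
  have hNtop : (N : ℝ≥0∞) ≠ ∞ := ENNReal.natCast_ne_top N
  refine ⟨N, (N : ℝ≥0∞)⁻¹ * (N : ℝ≥0∞)⁻¹, mul_ne_zero (ENNReal.inv_ne_zero.2 hNtop)
    (ENNReal.inv_ne_zero.2 hNtop), fun B hBZ hB htB a ha => ?_⟩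
  by_contra! hcon
  let b : ℕ → G := fun k => if hk : k < N then a ⟨k, hk⟩ else 1
  have hb : ∀ k (hk : k < N), b k = a ⟨k, hk⟩ := fun k hk => dif_pos hk
  let F : ℕ → Set G := fun r => b '' (Finset.range r : Set ℕ)
  have hF : ∀ r, (F r).Finite := fun r => (Finset.finite_toSet _).image _
  have hFsucc : ∀ r, F (r + 1) = insert (b r) (F r) := fun r => by
    simp only [F, Finset.range_add_one, Finset.coe_insert, Set.image_insert_eq]
  have hBU := hB.mul hU
  have hsmall : ∀ r, r < N → ∀ s ≤ r, μ (b r • B ∩ (F s * (B * U))) ≤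
      s * ((N : ℝ≥0∞)⁻¹ * (N : ℝ≥0∞)⁻¹) := by
    intro r hr s
    induction s with
    | zero => intro _; simp [F, h.empty]
    | succ s ih =>
      intro hs
      rw [hFsucc, Set.insert_mul_eq_smul_union, Set.inter_union_distrib_left]
      have e : b r • B ∩ b s • (B * U) = b r • (B ∩ ((b r)⁻¹ * b s) • (B * U)) := by
        rw [Set.smul_set_inter, smul_smul, mul_inv_cancel_left]
      have h₁ := (hcon ⟨s, by omega⟩ ⟨r, hr⟩ (by simpa using hs)).le
      rw [← hb, ← hb] at h₁
      refine (h.subadditive _ _ ((hB.smul _).inter (hBU.smul _))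
        ((hB.smul _).inter (.finite_mul (hF s) hBU))).trans ?_
      rw [e, h.smul _ _ (hB.inter (hBU.smul _)), add_comm]
      push_cast
      rw [add_mul, one_mul]
      exact add_le_add (ih (by omega)) h₁
  have key : ∀ r ≤ N, ∃ E ⊆ F r * B, 𝔾.IsDefinable E ∧ r * t ≤ μ E + r * (N : ℝ≥0∞)⁻¹ := by
    intro r
    induction r with
    | zero => intro _; exact ⟨∅, Set.empty_subset _, isDefinable_empty, by simp⟩
    | succ r ih =>
      intro hr
      obtain ⟨E, hEF, hE, hEt⟩ := ih (by omega)
      have hW := (hB.smul (b r)).diff (.finite_mul (hF r) hBU)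
      -- The removed overlap has measure at most `r / N ^ 2 ≤ 1 / N`. What remains of `b r • B`
      -- misses `E * U`, since `E ⊆ F r * B`, so additivity applies.
      refine ⟨b r • B \ (F r * (B * U)) ∪ E, ?_, hW.union hE, ?_⟩
      · rw [hFsucc, Set.insert_mul_eq_smul_union]
        exact Set.union_subset_union Set.sdiff_subset hEF
      · rw [h.additive _ _ hW hE]
        · have h₁ : μ (b r • B) ≤ μ (b r • B ∩ (F r * (B * U))) + μ (b r • B \ (F r * (B * U))) := by
            refine le_trans (le_of_eq ?_) (h.subadditive _ _ ((hB.smul _).inter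
              (.finite_mul (hF r) hBU)) hW)
            rw [Set.inter_union_sdiff]
          have h₂ : (r : ℝ≥0∞) * ((N : ℝ≥0∞)⁻¹ * (N : ℝ≥0∞)⁻¹) ≤ (N : ℝ≥0∞)⁻¹ := by
            rw [← mul_assoc]
            refine mul_le_of_le_one_left' ?_
            rw [← div_eq_mul_inv]
            refine ENNReal.div_le_of_le_mul ?_
            rw [one_mul]
            exact_mod_cast (by omega : r ≤ N)
          rw [h.smul _ _ hB] at h₁
          have h₃ := htB.trans (h₁.trans (add_le_add_left ((hsmall r (by omega) r le_rfl).trans h₂) _))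
          push_cast
          calc ((r : ℝ≥0∞) + 1) * t = r * t + t := by ring
            _ ≤ (μ E + r * (N : ℝ≥0∞)⁻¹) + ((N : ℝ≥0∞)⁻¹ + μ (b r • B \ (F r * (B * U)))) :=
              add_le_add hEt h₃
            _ = _ := by ring
        · refine Set.eq_empty_iff_forall_notMem.2 ?_
          rintro _ ⟨⟨_, hx⟩, x, hxE, u, hu, rfl⟩
          obtain ⟨f, hf, y, hy, rfl⟩ := hEF hxE
          exact hx ⟨f, hf, y * u, ⟨y, hy, u, hu, rfl⟩, (mul_assoc _ _ _).symm⟩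
  obtain ⟨E, hEF, hE, hEt⟩ := key N le_rfl
  rw [ENNReal.mul_inv_cancel hN0 hNtop] at hEt
  have hFH : F N ⊆ H := by
    rintro _ ⟨k, hk, rfl⟩
    have hk : k < N := by simpa using hk
    rw [hb k hk]
    exact ha _
  have := h.mono _ _ hE hD (hEF.trans ((Set.mul_subset_mul hFH hBZ).trans hHZ))
  exact absurd (hN.trans_le (hEt.trans (add_le_add_left this 1))) (lt_irrefl _)

/-- Sets of measure at least `t`, in a set of finite measure, are uniformly iteratedly large. -/
theorem exists_isLarge (h : IsInvariantRoughMeasure 𝔾 U μ) (hU : 𝔾.IsDefinable U)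
    {H Z D : Set G} (hD : 𝔾.IsDefinable D) (hHZ : H * Z ⊆ D) (hfin : μ D ≠ ∞) (k : ℕ) {t : ℝ≥0∞}
    (ht : t ≠ 0) : ∃ l : List ℕ, l.length = k ∧ ∀ B ⊆ Z, 𝔾.IsDefinable B → t ≤ μ B →
      IsLarge H U l B := by
  induction k generalizing t with
  | zero =>
    refine ⟨[], rfl, fun B _ _ hB => Set.nonempty_iff_ne_empty.2 ?_⟩
    rintro rfl
    exact ht (by simpa [h.empty] using hB)
  | succ k ih =>
    obtain ⟨N, t', ht', hN⟩ := h.exists_large_inter hU hD hHZ hfin ht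
    obtain ⟨l, hl, hl'⟩ := ih ht'
    refine ⟨N :: l, by simp [hl], fun B hBZ hB htB a ha => ?_⟩
    obtain ⟨i, j, hij, hij'⟩ := hN B hBZ hB htB a ha
    exact ⟨i, j, hij, hl' _ (Set.inter_subset_left.trans hBZ)
      (hB.inter ((hB.mul hU).smul _)) hij'⟩

/-- Products of elements which almost stabilise `P`. -/
theorem pow_subset_of_almost_stabilizer (h : IsInvariantRoughMeasure 𝔾 U μ)
    (hU : 𝔾.IsDefinable U) {P Y : Set G} (hP : 𝔾.IsDefinable P) (hpos : μ P ≠ 0)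
    (hfin : μ P ≠ ∞) {δ : ℝ≥0∞} (hY : ∀ g ∈ Y, μ P ≤ μ (P ∩ g • P) + δ * μ P) {m : ℕ}
    (hm : m * δ < 1) : Y ^ m ⊆ P * (U⁻¹) ^ m * P⁻¹ := by
  -- A further factor `g` replaces `E` by `g • (P ∩ g⁻¹ • P ∩ E * U)`, at the price of one factor
  -- `U` and of `δ * μ P` in measure. The part of `P ∩ g⁻¹ • P` outside `E * U` is additive with `E`
  -- inside `P`, which bounds what is lost.
  have key : ∀ n : ℕ, ∀ w ∈ Y ^ n, ∃ E ⊆ P ∩ w • (P * U ^ n), 𝔾.IsDefinable E ∧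
      μ P ≤ μ E + n * δ * μ P := by
    intro n
    induction n with
    | zero =>
      intro w hw
      obtain rfl : w = 1 := by simpa using hw
      exact ⟨P, by simp, hP, by simp⟩
    | succ n ih =>
      intro w hw
      rw [pow_succ'] at hw
      obtain ⟨g, hg, w, hw, rfl⟩ := hw
      obtain ⟨E, hE, hEdef, hEm⟩ := ih w hw
      have hG := hP.inter (hP.smul g⁻¹)
      have hEU := hEdef.mul hU
      have hI := hG.inter hEU
      have hW := hG.diff hEU
      have h₁ : μ P ≤ μ (P ∩ g⁻¹ • P) + δ * μ P := by
        rw [← h.smul g _ hG, Set.smul_set_inter, smul_inv_smul, Set.inter_comm]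
        exact hY g hg
      have h₂ : μ (P ∩ g⁻¹ • P) ≤ μ ((P ∩ g⁻¹ • P) ∩ (E * U)) + μ ((P ∩ g⁻¹ • P) \ (E * U)) := by
        refine le_trans (le_of_eq ?_) (h.subadditive _ _ hI hW)
        rw [Set.inter_union_sdiff]
      have h₃ : μ ((P ∩ g⁻¹ • P) \ (E * U)) + μ E ≤ μ P := by
        rw [← h.additive _ _ hW hEdef (by rw [Set.sdiff_inter_self])]
        exact h.mono _ _ (hW.union hEdef) hP (Set.union_subset
          (Set.sdiff_subset.trans Set.inter_subset_left) (hE.trans Set.inter_subset_left))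
      refine ⟨g • ((P ∩ g⁻¹ • P) ∩ (E * U)), Set.subset_inter ?_ ?_, hI.smul g, ?_⟩
      · rintro _ ⟨x, ⟨⟨-, hx⟩, -⟩, rfl⟩
        simpa using Set.mem_smul_set_iff_inv_smul_mem.1 hx
      · rintro _ ⟨x, ⟨-, e, he, u, hu, rfl⟩, rfl⟩
        obtain ⟨_, ⟨p, hp, v, hv, rfl⟩, rfl⟩ := (hE he).2
        refine ⟨p * (v * u), ⟨p, hp, v * u, ?_, rfl⟩, by simp [mul_assoc]⟩
        rw [pow_succ]
        exact ⟨v, hv, u, hu, rfl⟩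
      · rw [h.smul g _ hI]
        refine ENNReal.le_of_add_le_add_left hfin ?_
        calc μ P + μ P ≤ (μ ((P ∩ g⁻¹ • P) ∩ (E * U)) + μ ((P ∩ g⁻¹ • P) \ (E * U)) + δ * μ P) +
              (μ E + n * δ * μ P) := add_le_add (h₁.trans (add_le_add_left h₂ _)) hEm
          _ = (μ ((P ∩ g⁻¹ • P) \ (E * U)) + μ E) +
              (μ ((P ∩ g⁻¹ • P) ∩ (E * U)) + (n + 1) * δ * μ P) := by ring
          _ ≤ _ := by push_cast; gcongr
  intro w hw
  obtain ⟨E, hE, -, hEm⟩ := key m w hw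
  have hne : E.Nonempty := by
    refine Set.nonempty_iff_ne_empty.2 ?_
    rintro rfl
    rw [h.empty, zero_add] at hEm
    refine absurd (hEm.trans_lt ?_) (lt_irrefl _)
    calc m * δ * μ P < 1 * μ P := (ENNReal.mul_lt_mul_iff_left hpos hfin).2 hm
      _ = μ P := one_mul _
  obtain ⟨e, he⟩ := hne
  obtain ⟨heP, _, ⟨p, hp, v, hv, rfl⟩, e'⟩ := hE he
  refine ⟨e * v⁻¹, ⟨e, heP, v⁻¹, ?_, rfl⟩, p⁻¹, by simpa, ?_⟩
  · rw [inv_pow]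
    simpa using hv
  · simp only [← e', smul_eq_mul]
    group

end IsInvariantRoughMeasure

variable {A U : Set G}

/-- Along the iterated intersections of a large set, some step does not decrease `f` by more than
the factor `ρ`. -/
theorem IsLarge.exists_stable (Q : Set G → Prop) (f : ℕ → Set G → ℝ≥0∞) {c ρ : ℝ≥0∞}
    (hf : ∀ s B, Q B → B.Nonempty → c ≤ f s B) {l : List ℕ} {s : ℕ} {B : Set G} (hQ : Q B)
    (hB : IsLarge A U l B) (hc : ρ ^ l.length * f s B < c) :
    ∃ N l' B' s', s ≤ s' ∧ s' < s + l.length ∧ Q B' ∧ IsLarge A U (N :: l') B' ∧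
      ∀ C, Q C → IsLarge A U l' C → ρ * f s' B' ≤ f (s' + 1) C := by
  induction l generalizing s B with
  | nil => exact absurd (hf s B hQ hB) (not_le.2 (by simpa using hc))
  | cons N l ih =>
    -- Each unstable step multiplies `f` by less than `ρ`. If all were unstable, `f` would fall
    -- below its lower bound `c`.
    by_cases hC : ∀ C, Q C → IsLarge A U l C → ρ * f s B ≤ f (s + 1) C
    · exact ⟨N, l, B, s, le_rfl, by simp, hQ, hB, hC⟩
    · push Not at hC
      obtain ⟨C, hQC, hC, hlt⟩ := hC
      obtain ⟨N', l', B', s', h₁, h₂, h₃⟩ := ih hQC hC (by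
        refine lt_of_le_of_lt ?_ hc
        rw [List.length_cons, pow_succ, mul_assoc]
        gcongr)
      exact ⟨N', l', B', s', by omega, by simp; omega, h₃⟩

/-- Without a finite cover, `A` contains an infinite sequence with `x⁻¹ * y ∉ Y` whenever `x`
precedes `y`. Its first `N` terms contradict largeness of `B`. -/
theorem IsLarge.exists_finite_cover {N : ℕ} {l : List ℕ} {B : Set G}
    (hB : IsLarge A U (N :: l) B) {Y : Set G}
    (hY : ∀ g, IsLarge A U l (B ∩ g • (B * U)) → g⁻¹ ∈ Y) :
    ∃ F ⊆ A, F.Finite ∧ A ⊆ F * Y := by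
  by_contra! hcon
  obtain ⟨a, ha, har⟩ := exists_seq_of_forall_finset_exists (· ∈ A)
    (fun x y => x⁻¹ * y ∉ Y) (fun s hs => by
      obtain ⟨y, hy, hyY⟩ := Set.not_subset.1 (hcon (s : Set G) hs s.finite_toSet)
      exact ⟨y, hy, fun x hx hxy => hyY ⟨x, hx, _, hxy, by simp⟩⟩)
  obtain ⟨i, j, hij, h⟩ := hB (fun k => a k) fun k => ha k
  exact har i j hij (by simpa using hY _ h)

end InvariantRoughMeasure

theorem IsLarge.nonempty {G : Type*} [Group G] {A U : Set G} (hA : A.Nonempty) {l : List ℕ}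
    {B : Set G} (hB : IsLarge A U l B) : B.Nonempty := by
  induction l generalizing B with
  | nil => exact hB
  | cons N l ih =>
    obtain ⟨a, ha⟩ := hA
    obtain ⟨i, j, -, h⟩ := hB (fun _ => a) fun _ => ha
    exact (ih h).mono Set.inter_subset_left

/-- If `H` is covered by finitely many translates of each of finitely many sets `Y i`, then it is
covered by finitely many translates of the intersection of the sets `(Y i)⁻¹ * Y i`. -/
theorem exists_finite_common_cover {G ι : Type*} [Group G] [Finite ι] {H : Set G}
    {F Y : ι → Set G} (hF : ∀ i, (F i).Finite) (h : ∀ i, H ⊆ F i * Y i) :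
    ∃ E ⊆ H, E.Finite ∧ ∀ x ∈ H, ∃ e ∈ E, ∀ i, e⁻¹ * x ∈ (Y i)⁻¹ * Y i := by
  have h' : ∀ i, ∀ x ∈ H, ∃ c ∈ F i, ∃ y ∈ Y i, c * y = x := fun i x hx => h i hx
  choose! c hc y hy hcy using h'
  -- `E` contains one representative for each of the finitely many tuples of centres that occur.
  obtain ⟨E, hE, hbij⟩ := (Set.surjOn_image (fun x i => c i x) H).exists_bijOn_subset
  have hfin : ((fun x i => c i x) '' H).Finite := by
    refine (Set.Finite.pi' hF).subset ?_
    rintro _ ⟨x, hx, rfl⟩ i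
    exact hc i x hx
  refine ⟨E, hE, hbij.finite_iff_finite.2 hfin, fun x hx => ?_⟩
  obtain ⟨e, he, hex⟩ := hbij.surjOn ⟨x, hx, rfl⟩
  refine ⟨e, he, fun i => ⟨(y i e)⁻¹, by simpa using hy i e (hE he), y i x, hy i x hx, ?_⟩⟩
  have h₁ := congrFun hex i
  have h₂ := hcy i x hx
  have h₃ := hcy i e (hE he)
  simp only at h₁ h₂ h₃ ⊢
  have h₄ : e⁻¹ * x = (c i e * y i e)⁻¹ * (c i x * y i x) := by rw [h₂, h₃]
  rw [h₄, h₁]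
  group

/-! ### Thickening sequences, thick subsets and the measures of powers of `A`. -/

section RoughAmenable

open MSLanguage.Struc.DefinableGroup

variable {L : MSLanguage.{u}} {M : L.Struc} {G : Type u} [Group G] {𝔾 : M.DefinableGroup G}
  {A : Set G} {T : ℕ → Set G} {μ : ℕ → Set G → ℝ≥0∞}

namespace IsThickeningSequence

theorem one_mem (hT : IsThickeningSequence 𝔾 A T) (i : ℕ) : (1 : G) ∈ T i := (hT.symmetric i).1

theorem inv_eq (hT : IsThickeningSequence 𝔾 A T) (i : ℕ) : (T i)⁻¹ = T i := (hT.symmetric i).2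

theorem antitone (hT : IsThickeningSequence 𝔾 A T) : Antitone T :=
  antitone_nat_of_succ_le fun i =>
    (Set.subset_mul_left _ (hT.one_mem (i + 1))).trans (hT.sq_subset i)

theorem mul_subset (hT : IsThickeningSequence 𝔾 A T) {i j k : ℕ} (hj : i + 1 ≤ j)
    (hk : i + 1 ≤ k) : T j * T k ⊆ T i :=
  (Set.mul_subset_mul (hT.antitone hj) (hT.antitone hk)).trans (hT.sq_subset i)

theorem pow_subset (hT : IsThickeningSequence 𝔾 A T) (i m : ℕ) : T (i + m) ^ m ⊆ T i := by
  induction m generalizing i with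
  | zero => simpa using hT.one_mem i
  | succ m ih =>
    rw [pow_succ]
    refine (Set.mul_subset_mul_right ?_).trans (hT.mul_subset (i := i) le_rfl
      (show i + 1 ≤ i + (m + 1) by omega))
    have := ih (i + 1)
    rwa [show i + 1 + m = i + (m + 1) by omega] at this

theorem conj_mem (hT : IsThickeningSequence 𝔾 A T) {i m : ℕ} {z t : G} (hz : z ∈ A ^ m)
    (ht : t ∈ T (i + m)) : z⁻¹ * t * z ∈ T i := by
  induction m generalizing i z with
  | zero =>
    obtain rfl : z = 1 := by simpa using hz
    simpa using ht
  | succ m ih =>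
    rw [pow_succ] at hz
    obtain ⟨z, hz, a, ha, rfl⟩ := hz
    have := hT.conj_subset i a ha _ (ih (i := i + 1) hz (by convert ht using 2; omega))
    convert this using 1
    simp only
    group

/-- Conjugation by one element of `A` costs one index. Most index shifts below count such exchanges,
and the others count products of thickenings. -/
theorem swap (hT : IsThickeningSequence 𝔾 A T) {i k m : ℕ} {Z : Set G} (hZ : Z ⊆ A ^ m)
    (hk : i + m ≤ k) : T k * Z ⊆ Z * T i := by
  rintro _ ⟨t, ht, z, hz, rfl⟩
  exact ⟨z, hz, z⁻¹ * t * z, hT.conj_mem (hZ hz) (hT.antitone hk ht), by simp [mul_assoc]⟩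

end IsThickeningSequence

/-- A symmetric set `A` which is rough definably amenable, with `A ^ 4` of finite measure. -/
structure IsFiniteRoughAmenable (𝔾 : M.DefinableGroup G) (A : Set G) (T : ℕ → Set G)
    (μ : ℕ → Set G → ℝ≥0∞) : Prop where
  definable : 𝔾.IsDefinable A
  symmetric : IsSymmetricSet A
  thickening : IsThickeningSequence 𝔾 A T
  rough : ∀ i, IsInvariantRoughMeasure 𝔾 (T i) (μ i)
  normalised : ∀ i, μ i A = 1
  finite_four : ∀ i, ∃ n, μ i (A ^ 4 * T n) ≠ ∞

/-- Definable symmetric subsets of `A ^ 2`, finitely many translates of which cover `A`. -/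
structure IsThickSubset (𝔾 : M.DefinableGroup G) (A Z : Set G) : Prop where
  definable : 𝔾.IsDefinable Z
  symmetric : IsSymmetricSet Z
  subset_sq : Z ⊆ A ^ 2
  covers : ∃ F ⊆ A, F.Finite ∧ A ⊆ F * Z

theorem IsThickSubset.pow_subset {Z : Set G} (hZ : IsThickSubset 𝔾 A Z) (m : ℕ) :
    Z ^ m ⊆ A ^ (2 * m) := by
  rw [pow_mul]
  exact Set.pow_subset_pow_left hZ.subset_sq

theorem IsThickSubset.pow_inv {Z : Set G} (hZ : IsThickSubset 𝔾 A Z) (m : ℕ) :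
    (Z ^ m)⁻¹ = Z ^ m := by
  rw [← inv_pow, hZ.symmetric.2]

namespace IsFiniteRoughAmenable

variable {Z X : Set G}

theorem definable_mul (h : IsFiniteRoughAmenable 𝔾 A T μ) (m n : ℕ) :
    𝔾.IsDefinable (A ^ m * T n) := (h.definable.pow m).mul (h.thickening.definable n)

theorem subset_mul (h : IsFiniteRoughAmenable 𝔾 A T μ) (X : Set G) (n : ℕ) : X ⊆ X * T n :=
  Set.subset_mul_left _ (h.thickening.one_mem n)

theorem inv_mem (h : IsFiniteRoughAmenable 𝔾 A T μ) {a : G} (ha : a ∈ A) : a⁻¹ ∈ A := by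
  rw [← h.symmetric.2]
  simpa using ha

/-- The translates of `A` by elements of `A ^ 3` lie in `A ^ 4`, so finiteness of some `μ (i + 1) (A
^ 4 * T n)` bounds a disjoint family of them. -/
theorem exists_cover_cube (h : IsFiniteRoughAmenable 𝔾 A T μ) (i : ℕ) :
    ∃ F : Set G, F.Finite ∧ A ^ 3 ⊆ F * (A ^ 2 * T i) := by
  obtain ⟨n, hn⟩ := h.finite_four (i + 1)
  obtain ⟨F, -, hF, hAF⟩ := (h.rough (i + 1)).exists_finite_cover (H := A ^ 3) h.definable
    (h.definable_mul 4 n) (by simp [h.normalised]) (h.subset_mul _ n) hn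
  refine ⟨F, hF, hAF.trans (Set.mul_subset_mul_left ?_)⟩
  rw [h.symmetric.2, pow_two, mul_assoc, mul_assoc]
  exact Set.mul_subset_mul_left (h.thickening.swap (m := 1) (by simp) le_rfl)

theorem exists_cover_pow (h : IsFiniteRoughAmenable 𝔾 A T μ) (m i : ℕ) :
    ∃ F : Set G, F.Finite ∧ A ^ m ⊆ F * (A ^ 2 * T i) := by
  induction m generalizing i with
  | zero =>
    refine ⟨{1}, Set.finite_singleton _, ?_⟩
    rw [pow_zero, Set.singleton_one, one_mul, Set.one_subset]
    exact h.subset_mul _ i (Set.one_mem_pow h.symmetric.1)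
  | succ m ih =>
    obtain ⟨F, hF, hAF⟩ := ih (i + 2)
    obtain ⟨E, hE, hAE⟩ := h.exists_cover_cube (i + 1)
    refine ⟨F * E, hF.mul hE, ?_⟩
    have h₁ : T (i + 2) * A ⊆ A * T (i + 1) := h.thickening.swap (m := 1) (by simp) le_rfl
    have h₂ : T (i + 1) * T (i + 1) ⊆ T i := h.thickening.sq_subset i
    calc A ^ (m + 1) = A ^ m * A := pow_succ _ _
      _ ⊆ F * (A ^ 2 * T (i + 2)) * A := Set.mul_subset_mul_right hAF
      _ = F * (A ^ 2 * (T (i + 2) * A)) := by simp only [mul_assoc]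
      _ ⊆ F * (A ^ 2 * (A * T (i + 1))) := by gcongr
      _ = F * (A ^ 3 * T (i + 1)) := by simp only [pow_succ, pow_zero, one_mul, mul_assoc]
      _ ⊆ F * (E * (A ^ 2 * T (i + 1)) * T (i + 1)) := by gcongr
      _ = F * E * (A ^ 2 * (T (i + 1) * T (i + 1))) := by simp only [mul_assoc]
      _ ⊆ F * E * (A ^ 2 * T i) := by gcongr

theorem exists_finite_pow (h : IsFiniteRoughAmenable 𝔾 A T μ) (m i : ℕ) :
    ∃ n₀, ∀ n, n₀ ≤ n → μ i (A ^ m * T n) ≠ ∞ := by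
  obtain ⟨n, hn⟩ := h.finite_four i
  obtain ⟨F, hF, hAF⟩ := h.exists_cover_pow m (n + 1)
  refine ⟨n + 1, fun k hk => ne_top_of_le_ne_top
    ((h.rough i).finite_mul_ne_top hF (h.definable_mul 4 n) hn) ((h.rough i).mono _ _
      (h.definable_mul m k) (.finite_mul hF (h.definable_mul 4 n)) ?_)⟩
  have h₁ : T (n + 1) * T k ⊆ T n := h.thickening.mul_subset le_rfl hk
  have h₂ : A ^ 2 ⊆ A ^ 4 := Set.pow_subset_pow_right h.symmetric.1 (by norm_num)
  calc A ^ m * T k ⊆ F * (A ^ 2 * T (n + 1)) * T k := by gcongr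
    _ = F * (A ^ 2 * (T (n + 1) * T k)) := by simp only [mul_assoc]
    _ ⊆ F * (A ^ 4 * T n) := by gcongr

theorem measure_pow_lt_top (h : IsFiniteRoughAmenable 𝔾 A T μ) (m i : ℕ) : μ i (A ^ m) < ∞ := by
  obtain ⟨n, hn⟩ := h.exists_finite_pow m i
  exact (((h.rough i).mono _ _ (h.definable.pow m) (h.definable_mul m n)
    (h.subset_mul _ n)).trans_lt (hn n le_rfl).lt_top)

theorem measure_ne_zero (h : IsFiniteRoughAmenable 𝔾 A T μ) (hZ : IsThickSubset 𝔾 A Z) (i : ℕ) :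
    μ i Z ≠ 0 := by
  intro h0
  obtain ⟨F, -, hF, hAF⟩ := hZ.covers
  have := ((h.rough i).mono _ _ h.definable (.finite_mul hF hZ.definable) hAF).trans
    ((h.rough i).finite_mul_le hF hZ.definable)
  rw [h.normalised, h0, mul_zero] at this
  exact absurd this (by simp)

/-- A thick set has positive measure, because finitely many translates of it cover `A`. The shift by
`2` pays for moving `T` past `Z ⊆ A ^ 2`. -/
theorem exists_cover_sq (h : IsFiniteRoughAmenable 𝔾 A T μ) (hZ : IsThickSubset 𝔾 A Z) (m l : ℕ) :
    ∃ F ⊆ A ^ m, F.Finite ∧ A ^ m ⊆ F * (Z ^ 2 * T l) := by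
  obtain ⟨n, hn⟩ := h.exists_finite_pow (m + 2) (l + 2)
  obtain ⟨F, hFA, hF, hAF⟩ := (h.rough (l + 2)).exists_finite_cover (H := A ^ m) hZ.definable
    (h.definable_mul (m + 2) n) (h.measure_ne_zero hZ _) (by
      rw [pow_add]
      exact (Set.mul_subset_mul_left hZ.subset_sq).trans (h.subset_mul _ n)) (hn n le_rfl)
  refine ⟨F, hFA, hF, hAF.trans (Set.mul_subset_mul_left ?_)⟩
  rw [hZ.symmetric.2, pow_two, mul_assoc, mul_assoc]
  exact Set.mul_subset_mul_left (h.thickening.swap hZ.subset_sq le_rfl)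

theorem isThickSubset_self (h : IsFiniteRoughAmenable 𝔾 A T μ) : IsThickSubset 𝔾 A A where
  definable := h.definable
  symmetric := h.symmetric
  subset_sq := by
    rw [pow_two]
    exact Set.subset_mul_left _ h.symmetric.1
  covers := ⟨{1}, by simpa using h.symmetric.1, Set.finite_singleton _, by simp⟩

theorem inv_mul_mem_sq (h : IsFiniteRoughAmenable 𝔾 A T μ) {a b : G} (ha : a ∈ A) (hb : b ∈ A) :
    a⁻¹ * b ∈ A ^ 2 := by
  rw [pow_two]
  exact ⟨a⁻¹, h.inv_mem ha, b, hb, rfl⟩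

theorem isSymmetricSet_sq (h : IsFiniteRoughAmenable 𝔾 A T μ) : IsSymmetricSet (A ^ 2) :=
  ⟨Set.one_mem_pow h.symmetric.1, by rw [← inv_pow, h.symmetric.2]⟩

/-- Squares appear because two elements with the same centres in both covers are only known to
differ by an element of `X⁻¹ * X` and of `Y⁻¹ * Y`. -/
theorem isThickSubset_inter (h : IsFiniteRoughAmenable 𝔾 A T μ) {X Y : Set G}
    (hX : IsThickSubset 𝔾 A X) (hY : IsThickSubset 𝔾 A Y) :
    IsThickSubset 𝔾 A (X ^ 2 ∩ Y ^ 2 ∩ A ^ 2) where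
  definable := ((hX.definable.pow 2).inter (hY.definable.pow 2)).inter (h.definable.pow 2)
  symmetric := ⟨⟨⟨Set.one_mem_pow hX.symmetric.1, Set.one_mem_pow hY.symmetric.1⟩,
    Set.one_mem_pow h.symmetric.1⟩, by
      rw [Set.inter_inv, Set.inter_inv, hX.pow_inv, hY.pow_inv, h.isSymmetricSet_sq.2]⟩
  subset_sq := Set.inter_subset_right
  covers := by
    obtain ⟨F₁, -, hF₁, h₁⟩ := hX.covers
    obtain ⟨F₂, -, hF₂, h₂⟩ := hY.covers
    obtain ⟨E, hEA, hE, hcov⟩ := exists_finite_common_cover (ι := Bool) (H := A)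
      (F := fun b => cond b F₁ F₂) (Y := fun b => cond b X Y)
      (by rintro (_ | _) <;> assumption) (by rintro (_ | _) <;> assumption)
    refine ⟨E, hEA, hE, fun a ha => ?_⟩
    obtain ⟨e, he, hea⟩ := hcov a ha
    refine ⟨e, he, e⁻¹ * a, ⟨⟨?_, ?_⟩, h.inv_mul_mem_sq (hEA he) ha⟩, by simp⟩
    · simpa [hX.symmetric.2, pow_two] using hea true
    · simpa [hY.symmetric.2, pow_two] using hea false

end IsFiniteRoughAmenable

end RoughAmenable

/-! ### Thick subsets with controlled powers and conjugates. -/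

section RoughAmenable

open MSLanguage.Struc.DefinableGroup

variable {L : MSLanguage.{u}} {M : L.Struc} {G : Type u} [Group G] {𝔾 : M.DefinableGroup G}
  {A : Set G} {T : ℕ → Set G} {μ : ℕ → Set G → ℝ≥0∞}

namespace IsFiniteRoughAmenable

variable {Z X : Set G}

/-- Inside `Z ^ 4`, up to a small thickening, there is an `m`-th power of a thick subset. -/
theorem exists_thick_pow_subset (h : IsFiniteRoughAmenable 𝔾 A T μ) (hZ : IsThickSubset 𝔾 A Z)
    (m j : ℕ) : ∃ X, IsThickSubset 𝔾 A X ∧ X ^ m ⊆ Z ^ 4 * T j := by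
  have hT := h.thickening
  -- At the end `T i ^ (m + 2) ⊆ T (j + 4)` is moved past `Z ^ 2 ⊆ A ^ 4`, which costs the `4`.
  obtain ⟨i, hi⟩ : ∃ i, i = j + 4 + (m + 2) := ⟨_, rfl⟩
  have hμ := h.rough i
  let δ : ℝ≥0∞ := ((m : ℝ≥0∞) + 1)⁻¹
  have hδ0 : δ ≠ 0 := ENNReal.inv_ne_zero.2 (by simp)
  have hδ1 : δ ≤ 1 := ENNReal.inv_le_one.2 le_add_self
  have hmδ : m * δ < 1 := by
    rw [← div_eq_mul_inv]
    refine ENNReal.div_lt_of_lt_mul ?_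
    rw [one_mul]
    exact_mod_cast Nat.lt_succ_self m
  obtain ⟨n₀, hn₀⟩ := h.exists_finite_pow 4 i
  obtain ⟨i₀, hi₀⟩ : ∃ i₀, i₀ = max i n₀ := ⟨_, rfl⟩
  have hK := hn₀ i₀ (by omega)
  -- After `k` losses of a factor `1 - δ`, the measure of `B * (Z * T s)` would be below `μ i Z`,
  -- which is impossible for nonempty `B`.
  obtain ⟨k, hk⟩ : ∃ k : ℕ, (1 - δ) ^ k * μ i (A ^ 4 * T i₀) < μ i Z := by
    have h₁ : Filter.Tendsto (fun k => (1 - δ) ^ k * μ i (A ^ 4 * T i₀)) Filter.atTop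
        (nhds (0 * μ i (A ^ 4 * T i₀))) :=
      ENNReal.Tendsto.mul_const (ENNReal.tendsto_pow_atTop_nhds_zero_of_lt_one
        (ENNReal.sub_lt_self ENNReal.one_ne_top one_ne_zero hδ0)) (Or.inr hK)
    rw [zero_mul] at h₁
    exact (h₁.eventually (gt_mem_nhds (h.measure_ne_zero hZ i).bot_lt)).exists
  -- The stable stage has `s < i₀ + k`, so `T n` can be moved past `Z ⊆ A ^ 2` into `T (s + 1)`.
  -- Largeness comes from `μ n`, growth is measured by `μ i`; the index `i` is fixed first since
  -- `k`, and hence `n`, depends on it.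
  obtain ⟨n, hn⟩ : ∃ n, n = i₀ + k + 3 := ⟨_, rfl⟩
  obtain ⟨n₁, hn₁⟩ := h.exists_finite_pow 3 n
  obtain ⟨l, hl, hlarge⟩ := (h.rough n).exists_isLarge (hT.definable n) (H := A) (Z := Z)
    (h.definable_mul 3 n₁) (by
      rw [pow_succ']
      exact (Set.mul_subset_mul_left hZ.subset_sq).trans (h.subset_mul _ n₁)) (hn₁ n₁ le_rfl) k
    (h.measure_ne_zero hZ n)
  have hdef : ∀ s B, 𝔾.IsDefinable B → 𝔾.IsDefinable (B * (Z * T s)) := fun s B hB =>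
    hB.mul (hZ.definable.mul (hT.definable s))
  have hsub : ∀ s, i₀ ≤ s → ∀ B ⊆ Z, B * (Z * T s) ⊆ A ^ 4 * T i₀ := fun s hs B hB => by
    calc B * (Z * T s) ⊆ Z * (Z * T i₀) := by
          have := hT.antitone hs
          gcongr
      _ = Z ^ 2 * T i₀ := by rw [pow_two, mul_assoc]
      _ ⊆ _ := Set.mul_subset_mul_right (hZ.pow_subset 2)
  have hlow : ∀ s B, (𝔾.IsDefinable B ∧ B ⊆ Z) → B.Nonempty → μ i Z ≤ μ i (B * (Z * T s)) := by
    rintro s B ⟨hB, -⟩ ⟨b, hb⟩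
    rw [← hμ.smul b Z hZ.definable]
    refine hμ.mono _ _ (hZ.definable.smul b) (hdef s B hB) ?_
    exact (Set.smul_set_mono (h.subset_mul Z s)).trans (Set.smul_set_subset_mul hb)
  obtain ⟨N, l', B, s, hs, hs', ⟨hB, hBZ⟩, hBl, hstable⟩ := IsLarge.exists_stable
    (fun B => 𝔾.IsDefinable B ∧ B ⊆ Z) (fun s B => μ i (B * (Z * T s))) hlow (s := i₀)
    (ρ := 1 - δ) ⟨hZ.definable, subset_rfl⟩ (hlarge Z subset_rfl hZ.definable le_rfl) (by
      rw [hl]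
      refine lt_of_le_of_lt ?_ hk
      gcongr
      exact hμ.mono _ _ (hdef i₀ Z hZ.definable) (h.definable_mul 4 i₀) (hsub i₀ le_rfl Z subset_rfl))
  rw [hl] at hs'
  let P := B * (Z * T s)
  have hP : 𝔾.IsDefinable P := hdef s B hB
  have hBU := hB.mul (hT.definable n)
  let Y₀ : Set G := {g : G | IsLarge A (T n) l' (B ∩ g • (B * T n))}
  have hY₀ : 𝔾.IsDefinable Y₀ := h.definable.isLarge_inter_smul (hT.definable n) l' hB hBU
  have hgood₀ : ∀ g ∈ Y₀, μ i P ≤ μ i (P ∩ g • P) + δ * μ i P := by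
    intro g hg
    have hC := hB.inter (hBU.smul g)
    have h₁ := hstable _ ⟨hC, Set.inter_subset_left.trans hBZ⟩ hg
    -- Comparing level `s + 1` with level `s` leaves room to absorb the thickening `T n` of `B`.
    have h₂ : (B ∩ g • (B * T n)) * (Z * T (s + 1)) ⊆ P ∩ g • P := by
      refine Set.subset_inter (Set.mul_subset_mul Set.inter_subset_left
        (Set.mul_subset_mul_left (hT.antitone (by omega)))) ?_
      have h₃ : T n * Z ⊆ Z * T (s + 1) := hT.swap hZ.subset_sq (by omega)
      have h₄ : T (s + 1) * T (s + 1) ⊆ T s := hT.sq_subset s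
      refine (Set.mul_subset_mul_right Set.inter_subset_right).trans ?_
      rw [smul_mul_assoc]
      refine Set.smul_set_mono ?_
      calc B * T n * (Z * T (s + 1)) = B * (T n * Z * T (s + 1)) := by simp only [mul_assoc]
        _ ⊆ B * (Z * T (s + 1) * T (s + 1)) := by gcongr
        _ = B * (Z * (T (s + 1) * T (s + 1))) := by simp only [mul_assoc]
        _ ⊆ B * (Z * T s) := by gcongr
    have h₃ := h₁.trans (hμ.mono _ _ (hdef (s + 1) _ hC) (hP.inter (hP.smul g)) h₂)
    calc μ i P = (1 - δ + δ) * μ i P := by rw [tsub_add_cancel_of_le hδ1, one_mul]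
      _ = (1 - δ) * μ i P + δ * μ i P := add_mul _ _ _
      _ ≤ _ := add_le_add_left h₃ _
  let Y := Y₀ ∪ Y₀⁻¹ ∪ {1}
  have hY : 𝔾.IsDefinable Y := (hY₀.union hY₀.inv).union (isDefinable_singleton 1)
  have hYinv : Y⁻¹ = Y := by
    simp only [Y, Set.union_inv, inv_inv, Set.inv_singleton, inv_one]
    rw [Set.union_comm Y₀⁻¹]
  have hgood : ∀ g ∈ Y, μ i P ≤ μ i (P ∩ g • P) + δ * μ i P := by
    rintro g ((hg | hg) | rfl)
    · exact hgood₀ g hg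
    · have := hgood₀ g⁻¹ hg
      rwa [← hμ.smul g _ (hP.inter (hP.smul g⁻¹)), Set.smul_set_inter, smul_inv_smul,
        Set.inter_comm] at this
    · simp
  have hBne : B.Nonempty := hBl.nonempty ⟨1, h.symmetric.1⟩
  have hPpos : μ i P ≠ 0 := ne_bot_of_le_ne_bot (h.measure_ne_zero hZ i) (hlow s B ⟨hB, hBZ⟩ hBne)
  have hPfin : μ i P ≠ ∞ := ne_top_of_le_ne_top hK
    (hμ.mono _ _ hP (h.definable_mul 4 i₀) (hsub s hs B hBZ))
  have hpow := hμ.pow_subset_of_almost_stabilizer (hT.definable i) hP hPpos hPfin hgood hmδ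
  obtain ⟨F, hFA, hF, hcov⟩ := hBl.exists_finite_cover (Y := Y) fun g hg =>
    Or.inl (Or.inr (by simpa [Y₀] using hg))
  refine ⟨Y ∩ A ^ 2, ⟨hY.inter (h.definable.pow 2), ⟨⟨Or.inr rfl, h.isSymmetricSet_sq.1⟩, ?_⟩,
    Set.inter_subset_right, F, hFA, hF, fun a ha => ?_⟩, ?_⟩
  · rw [Set.inter_inv, hYinv, h.isSymmetricSet_sq.2]
  · obtain ⟨f, hf, y, hy, rfl⟩ := hcov ha
    exact ⟨f, hf, y, ⟨hy, by simpa using h.inv_mul_mem_sq (hFA hf) ha⟩, rfl⟩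
  · have hPZ : P ⊆ Z ^ 2 * T i := by
      rw [pow_two, mul_assoc]
      exact Set.mul_subset_mul hBZ (Set.mul_subset_mul_left (hT.antitone (by omega)))
    have hPZ' : P⁻¹ ⊆ T i * Z ^ 2 := by
      refine (Set.inv_subset_inv.2 hPZ).trans (le_of_eq ?_)
      rw [mul_inv_rev, hT.inv_eq, hZ.pow_inv]
    have h₁ : T i ^ (m + 2) ⊆ T (j + 4) := by
      rw [hi]
      exact hT.pow_subset _ _
    have h₂ : T (j + 4) * Z ^ 2 ⊆ Z ^ 2 * T j := hT.swap (hZ.pow_subset 2) le_rfl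
    calc (Y ∩ A ^ 2) ^ m ⊆ Y ^ m := Set.pow_subset_pow_left Set.inter_subset_left
      _ ⊆ P * (T i)⁻¹ ^ m * P⁻¹ := hpow
      _ ⊆ (Z ^ 2 * T i) * T i ^ m * (T i * Z ^ 2) := by
        rw [hT.inv_eq]
        gcongr
      _ = Z ^ 2 * (T i ^ (m + 2) * Z ^ 2) := by
        rw [pow_succ (T i), pow_succ' (T i)]
        simp only [mul_assoc]
      _ ⊆ Z ^ 2 * (T (j + 4) * Z ^ 2) := by gcongr
      _ ⊆ Z ^ 2 * (Z ^ 2 * T j) := by gcongr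
      _ = Z ^ 4 * T j := by rw [← mul_assoc, ← pow_add]

/-- Each further factor costs `18` indices: `16` to move past `X ^ 8 ⊆ A ^ 16`, and one for each of
two products of thickenings. -/
theorem exists_pow_thickening_subset (h : IsFiniteRoughAmenable 𝔾 A T μ)
    (hX : IsThickSubset 𝔾 A X) (m q : ℕ) :
    ∃ p₀, ∀ p, p₀ ≤ p → (T p * X ^ 8 * T p) ^ m ⊆ X ^ (8 * m) * T q := by
  have hT := h.thickening
  induction m generalizing q with
  | zero => exact ⟨0, fun p _ => by simpa using hT.one_mem q⟩
  | succ m ih =>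
    obtain ⟨p₀, hp₀⟩ := ih (q + 18)
    refine ⟨max p₀ (q + 18), fun p hp => ?_⟩
    have h₁ : T (q + 18) * T p ⊆ T (q + 17) := hT.mul_subset le_rfl (by omega)
    have h₂ : T (q + 17) * X ^ 8 ⊆ X ^ 8 * T (q + 1) := hT.swap (hX.pow_subset 8) (by omega)
    have h₃ : T (q + 1) * T p ⊆ T q := hT.mul_subset le_rfl (by omega)
    have h₄ := hp₀ p (by omega)
    calc (T p * X ^ 8 * T p) ^ (m + 1) = (T p * X ^ 8 * T p) ^ m * (T p * X ^ 8 * T p) := pow_succ _ _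
      _ ⊆ X ^ (8 * m) * T (q + 18) * (T p * X ^ 8 * T p) := by gcongr
      _ = X ^ (8 * m) * ((T (q + 18) * T p) * X ^ 8 * T p) := by simp only [mul_assoc]
      _ ⊆ X ^ (8 * m) * (T (q + 17) * X ^ 8 * T p) := by gcongr
      _ ⊆ X ^ (8 * m) * (X ^ 8 * T (q + 1) * T p) := by gcongr
      _ = X ^ (8 * (m + 1)) * (T (q + 1) * T p) := by
        rw [show 8 * (m + 1) = 8 * m + 8 by ring, pow_add]
        simp only [mul_assoc]
      _ ⊆ _ := by gcongr

/-- A thick subset whose conjugates under `A` lie near `X ^ 8`. -/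
theorem exists_thick_conj (h : IsFiniteRoughAmenable 𝔾 A T μ) (hX : IsThickSubset 𝔾 A X) (p : ℕ) :
    ∃ Z, IsThickSubset 𝔾 A Z ∧ ∀ a ∈ A, ∀ z ∈ Z, a⁻¹ * z * a ∈ T p * X ^ 8 * T p := by
  have hT := h.thickening
  have hQ : 𝔾.IsDefinable (T p * X ^ 8 * T p) :=
    ((hT.definable p).mul (hX.definable.pow 8)).mul (hT.definable p)
  have hQ1 : (1 : G) ∈ T p * X ^ 8 * T p :=
    ⟨1, ⟨1, hT.one_mem p, 1, Set.one_mem_pow hX.symmetric.1, one_mul 1⟩, 1, hT.one_mem p, one_mul 1⟩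
  have hQinv : (T p * X ^ 8 * T p)⁻¹ = T p * X ^ 8 * T p := by
    rw [mul_inv_rev, mul_inv_rev, hT.inv_eq, hX.pow_inv, mul_assoc]
  refine ⟨A ^ 2 ∩ {z | ∀ a ∈ A, a⁻¹ * z * a ∈ T p * X ^ 8 * T p},
    ⟨(h.definable.pow 2).inter (h.definable.forall_conj_mem hQ),
      ⟨⟨h.isSymmetricSet_sq.1, fun a _ => by simpa using hQ1⟩, ?_⟩, Set.inter_subset_left, ?_⟩,
    fun a ha z hz => hz.2 a ha⟩
  · rw [Set.inter_inv, h.isSymmetricSet_sq.2]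
    congr 1
    ext z
    refine forall₂_congr fun a _ => ?_
    rw [show a⁻¹ * z⁻¹ * a = (a⁻¹ * z * a)⁻¹ by group, ← Set.mem_inv, hQinv]
  -- Write `a = f * u` with `f` in the finite set `F` and `u ∈ X ^ 2 * T (p + 14)`. For each `f`,
  -- covering `A * f ⊆ A ^ 2` yields a cover of `A`; a common refinement over `f ∈ F` puts `f⁻¹ *
  -- (e⁻¹ * x) * f` in `T (p + 14) * X ^ 4 * T (p + 14)`. Conjugating by `u` then gives `X ^ 8`. The
  -- shift is `14 = 8 + 1 + 4 + 1`: two exchanges and two products.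
  · obtain ⟨F, hFA, hF, hAF⟩ := h.exists_cover_sq hX 1 (p + 14)
    obtain ⟨F₂, -, hF₂, hAF₂⟩ := h.exists_cover_sq hX 2 (p + 14)
    rw [pow_one] at hFA hAF
    have := hF.to_subtype
    obtain ⟨E, hEA, hE, hcov⟩ := exists_finite_common_cover (ι := F) (H := A) (F := fun _ => F₂)
      (Y := fun f => X ^ 2 * T (p + 14) * {(f : G)⁻¹}) (fun _ => hF₂) (fun f a ha => by
        obtain ⟨c, hc, y, hy, e⟩ := hAF₂ (show a * f ∈ A ^ 2 by
          rw [pow_two]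
          exact ⟨a, ha, f, hFA f.2, rfl⟩)
        refine ⟨c, hc, y * (f : G)⁻¹, ⟨y, hy, _, rfl, rfl⟩, ?_⟩
        simp only at e ⊢
        rw [← mul_assoc, e, mul_inv_cancel_right])
    refine ⟨E, hEA, hE, fun x hx => ?_⟩
    obtain ⟨e, he, hex⟩ := hcov x hx
    refine ⟨e, he, e⁻¹ * x, ⟨h.inv_mul_mem_sq (hEA he) hx, fun a ha => ?_⟩, by simp⟩
    obtain ⟨f, hf, u, hu, rfl⟩ := hAF ha
    have hfz : f⁻¹ * (e⁻¹ * x) * f ∈ T (p + 14) * X ^ 4 * T (p + 14) := by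
      have := hex ⟨f, hf⟩
      obtain ⟨v, hv, w, ⟨w, hw, _, rfl, rfl⟩, e'⟩ := this
      obtain ⟨v', hv', _, rfl, e''⟩ := hv
      have hv'' : v'⁻¹ ∈ T (p + 14) * X ^ 2 := by
        have := Set.inv_mem_inv.2 hv'
        rwa [mul_inv_rev, hT.inv_eq, hX.pow_inv] at this
      have : f⁻¹ * (e⁻¹ * x) * f = v'⁻¹ * w := by
        simp only at e' e''
        rw [← e', show v = (v' * f⁻¹)⁻¹ by rw [e'', inv_inv]]
        group
      rw [this, show T (p + 14) * X ^ 4 * T (p + 14) =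
        T (p + 14) * X ^ 2 * (X ^ 2 * T (p + 14)) by
          rw [show X ^ 4 = X ^ 2 * X ^ 2 by rw [← pow_add]]
          simp only [mul_assoc]]
      exact Set.mul_mem_mul hv'' hw
    have hu' : u⁻¹ ∈ T (p + 14) * X ^ 2 := by
      have := Set.inv_mem_inv.2 hu
      rwa [mul_inv_rev, hT.inv_eq, hX.pow_inv] at this
    have h₁ : T (p + 14) * X ^ 4 ⊆ X ^ 4 * T (p + 6) := hT.swap (hX.pow_subset 4) (by omega)
    have h₂ : T (p + 6) * T (p + 14) ⊆ T (p + 5) := hT.mul_subset (by omega) (by omega)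
    have h₃ : T (p + 5) * X ^ 2 ⊆ X ^ 2 * T (p + 1) := hT.swap (hX.pow_subset 2) (by omega)
    have h₄ : T (p + 1) * T (p + 14) ⊆ T p := hT.mul_subset (by omega) (by omega)
    have h₅ : T (p + 14) ⊆ T p := hT.antitone (by omega)
    have key : T (p + 14) * X ^ 2 * (T (p + 14) * X ^ 4 * T (p + 14)) * (X ^ 2 * T (p + 14)) ⊆
        T p * X ^ 8 * T p := by
      calc _ = T (p + 14) * X ^ 2 * (T (p + 14) * X ^ 4) * T (p + 14) * X ^ 2 * T (p + 14) := by
            simp only [mul_assoc]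
        _ ⊆ T (p + 14) * X ^ 2 * (X ^ 4 * T (p + 6)) * T (p + 14) * X ^ 2 * T (p + 14) := by gcongr
        _ = T (p + 14) * X ^ 2 * X ^ 4 * (T (p + 6) * T (p + 14)) * X ^ 2 * T (p + 14) := by
            simp only [mul_assoc]
        _ ⊆ T (p + 14) * X ^ 2 * X ^ 4 * T (p + 5) * X ^ 2 * T (p + 14) := by gcongr
        _ = T (p + 14) * X ^ 2 * X ^ 4 * (T (p + 5) * X ^ 2) * T (p + 14) := by
            simp only [mul_assoc]
        _ ⊆ T (p + 14) * X ^ 2 * X ^ 4 * (X ^ 2 * T (p + 1)) * T (p + 14) := by gcongr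
        _ = T (p + 14) * X ^ 8 * (T (p + 1) * T (p + 14)) := by
            rw [show X ^ 8 = X ^ 2 * X ^ 4 * X ^ 2 by simp only [← pow_add]]
            simp only [mul_assoc]
        _ ⊆ _ := by gcongr
    have := key (Set.mul_mem_mul (Set.mul_mem_mul hu' hfz) hu)
    convert this using 1
    simp only
    group

/-- The inductive step in the construction of a type-definable subgroup. -/
theorem exists_thick_step (h : IsFiniteRoughAmenable 𝔾 A T μ) (hZ : IsThickSubset 𝔾 A Z) (j : ℕ) :
    ∃ Z', IsThickSubset 𝔾 A Z' ∧ ∃ W : Set G, (∀ a ∈ A, ∀ z ∈ Z', a⁻¹ * z * a ∈ W) ∧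
      W ^ 8 ⊆ Z ^ 4 * T j ∧ W ^ 8 ⊆ A ^ 4 * T j := by
  have hT := h.thickening
  -- Here `128 = 2 * 8 * 8`: the intersection lies in `X₁ ^ 2`, `W` is a thickening of its eighth
  -- power, and `W ^ 8` is to be controlled.
  obtain ⟨X₁, hX₁, h₁⟩ := h.exists_thick_pow_subset hZ 128 (j + 1)
  obtain ⟨X₂, hX₂, h₂⟩ := h.exists_thick_pow_subset h.isThickSubset_self 128 (j + 1)
  have hX := h.isThickSubset_inter hX₁ hX₂
  obtain ⟨p, hp⟩ := h.exists_pow_thickening_subset hX 8 (j + 1)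
  obtain ⟨Z', hZ', hconj⟩ := h.exists_thick_conj hX p
  have h₃ : T (j + 1) * T (j + 1) ⊆ T j := hT.sq_subset j
  refine ⟨Z', hZ', _, hconj, (hp p le_rfl).trans ?_, (hp p le_rfl).trans ?_⟩
  · calc _ ⊆ (X₁ ^ 2) ^ (8 * 8) * T (j + 1) := Set.mul_subset_mul_right (Set.pow_subset_pow_left
          (Set.inter_subset_left.trans Set.inter_subset_left))
      _ = X₁ ^ 128 * T (j + 1) := by rw [← pow_mul]
      _ ⊆ Z ^ 4 * T (j + 1) * T (j + 1) := by gcongr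
      _ = Z ^ 4 * (T (j + 1) * T (j + 1)) := mul_assoc _ _ _
      _ ⊆ _ := by gcongr
  · calc _ ⊆ (X₂ ^ 2) ^ (8 * 8) * T (j + 1) := Set.mul_subset_mul_right (Set.pow_subset_pow_left
          (Set.inter_subset_left.trans Set.inter_subset_right))
      _ = X₂ ^ 128 * T (j + 1) := by rw [← pow_mul]
      _ ⊆ A ^ 4 * T (j + 1) * T (j + 1) := by gcongr
      _ = A ^ 4 * (T (j + 1) * T (j + 1)) := mul_assoc _ _ _
      _ ⊆ _ := by gcongr

end IsFiniteRoughAmenable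

end RoughAmenable

/-! ### The normal chain, its intersection and the index. -/

section RoughAmenable

open MSLanguage.Struc.DefinableGroup

variable {L : MSLanguage.{u}} {M : L.Struc} {G : Type u} [Group G] {𝔾 : M.DefinableGroup G}
  {A : Set G} {T : ℕ → Set G} {μ : ℕ → Set G → ℝ≥0∞}

theorem IsRoughAmenabilityWitness.isInvariantRoughMeasure
    (hμ : IsRoughAmenabilityWitness 𝔾 A T μ) (hA : 𝔾.IsDefinable A) (i : ℕ) :
    IsInvariantRoughMeasure 𝔾 (T i) (μ i) where
  toIsRoughMeasure := hμ.rough i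
  smul := hμ.invariant i
  empty := by
    -- Additivity gives `μ ∅ = μ ∅ + μ ∅`; cancelling needs `μ ∅` finite, which follows from `μ A =
    -- 1`.
    have h₁ := (hμ.rough i).additive ∅ ∅ isDefinable_empty isDefinable_empty (by simp)
    have h₂ := (hμ.rough i).mono ∅ A isDefinable_empty hA (Set.empty_subset A)
    rw [hμ.normalised] at h₂
    rw [Set.union_empty] at h₁
    have h₃ := ENNReal.add_right_inj (ne_top_of_le_ne_top ENNReal.one_ne_top h₂)
      (b := 0) (c := μ i ∅)
    rw [add_zero] at h₃
    exact (h₃.1 h₁).symm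

/-- By compactness, a definable superset of `A ^ 4 * ⋂ T j` of finite measure already contains some
`A ^ 4 * T n`. -/
theorem typeMeasure_lt_top_exists {κ : Cardinal.{u}} (hκ : ℵ₀ < κ) (hM : M.Saturated κ)
    (hA : 𝔾.IsDefinable A) (hT : IsThickeningSequence 𝔾 A T) {ν : Set G → ℝ≥0∞} {U : Set G}
    (hν : IsRoughMeasure 𝔾 U ν) (hfin : typeMeasure 𝔾 ν (A ^ 4 * ⋂ j, T j) < ∞) :
    ∃ n, ν (A ^ 4 * T n) ≠ ∞ := by
  simp only [typeMeasure, iInf_lt_iff] at hfin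
  obtain ⟨D, hD, hsub, hlt⟩ := hfin
  have hdef : ∀ n, 𝔾.IsDefinable (A ^ 4 * T n) := fun n => (hA.pow 4).mul (hT.definable n)
  rw [← iInter_mul_eq hκ hM hT.definable hT.antitone (hA.pow 4)] at hsub
  obtain ⟨n, hn⟩ := exists_subset_of_iInter_subset hκ hM hdef
    (fun m n hmn => Set.mul_subset_mul_left (hT.antitone hmn)) hD hsub
  exact ⟨n, ((hν.mono _ _ (hdef n) hD hn).trans_lt hlt).ne⟩

namespace IsThickeningSequence

theorem one_mem_iInter (hT : IsThickeningSequence 𝔾 A T) : (1 : G) ∈ ⋂ j, T j :=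
  Set.mem_iInter.2 hT.one_mem

theorem mul_mem_iInter (hT : IsThickeningSequence 𝔾 A T) {s t : G} (hs : s ∈ ⋂ j, T j)
    (ht : t ∈ ⋂ j, T j) : s * t ∈ ⋂ j, T j :=
  Set.mem_iInter.2 fun i => hT.sq_subset i
    (Set.mul_mem_mul (Set.mem_iInter.1 hs _) (Set.mem_iInter.1 ht _))

theorem inv_mem_iInter (hT : IsThickeningSequence 𝔾 A T) {t : G} (ht : t ∈ ⋂ j, T j) :
    t⁻¹ ∈ ⋂ j, T j :=
  Set.mem_iInter.2 fun i => by
    rw [← hT.inv_eq]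
    simpa using Set.mem_iInter.1 ht i

theorem iInter_mul_pow_subset (hT : IsThickeningSequence 𝔾 A T) (m : ℕ) :
    (⋂ j, T j) * A ^ m ⊆ A ^ m * ⋂ j, T j := by
  rintro _ ⟨t, ht, z, hz, rfl⟩
  exact ⟨z, hz, z⁻¹ * t * z, Set.mem_iInter.2 fun i => hT.conj_mem hz (Set.mem_iInter.1 ht _),
    by simp [mul_assoc]⟩

theorem mul_iInter_pow_subset (hT : IsThickeningSequence 𝔾 A T) (m : ℕ) :
    (A * ⋂ j, T j) ^ m ⊆ A ^ m * ⋂ j, T j := by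
  have h₂ : (⋂ j, T j) * (⋂ j, T j) ⊆ ⋂ j, T j := by
    rintro _ ⟨s, hs, t, ht, rfl⟩
    exact hT.mul_mem_iInter hs ht
  induction m with
  | zero => simpa using hT.one_mem
  | succ m ih =>
    have h₁ : (⋂ j, T j) * A ⊆ A * ⋂ j, T j := by simpa using hT.iInter_mul_pow_subset 1
    calc (A * ⋂ j, T j) ^ (m + 1) = (A * ⋂ j, T j) ^ m * (A * ⋂ j, T j) := pow_succ _ _
      _ ⊆ A ^ m * (⋂ j, T j) * (A * ⋂ j, T j) := by gcongr
      _ = A ^ m * ((⋂ j, T j) * A) * (⋂ j, T j) := by simp only [mul_assoc]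
      _ ⊆ A ^ m * (A * ⋂ j, T j) * (⋂ j, T j) := by gcongr
      _ = A ^ (m + 1) * ((⋂ j, T j) * (⋂ j, T j)) := by simp only [pow_succ, mul_assoc]
      _ ⊆ A ^ (m + 1) * ⋂ j, T j := by gcongr

theorem subset_closure (hT : IsThickeningSequence 𝔾 A T) :
    A ⊆ Subgroup.closure (A * ⋂ j, T j) :=
  (Set.subset_mul_left _ hT.one_mem_iInter).trans Subgroup.subset_closure

theorem pow_subset_closure (hT : IsThickeningSequence 𝔾 A T) (m : ℕ) :
    A ^ m ⊆ Subgroup.closure (A * ⋂ j, T j) := by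
  induction m with
  | zero => simp
  | succ m ih =>
    rw [pow_succ]
    rintro _ ⟨x, hx, a, ha, rfl⟩
    exact mul_mem (ih hx) (hT.subset_closure ha)

theorem pow_mul_subset_closure (hT : IsThickeningSequence 𝔾 A T) (hA : IsSymmetricSet A) (m : ℕ) :
    A ^ m * (⋂ j, T j) ⊆ Subgroup.closure (A * ⋂ j, T j) := by
  rintro _ ⟨x, hx, t, ht, rfl⟩
  exact mul_mem (hT.pow_subset_closure m hx)
    (Subgroup.subset_closure (Set.subset_mul_right _ hA.1 ht))

theorem exists_mem_of_mem_closure (hT : IsThickeningSequence 𝔾 A T) (hA : IsSymmetricSet A)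
    {x : G} (hx : x ∈ Subgroup.closure (A * ⋂ j, T j)) : ∃ m, x ∈ A ^ m * ⋂ j, T j := by
  induction hx using Subgroup.closure_induction with
  | mem x hx => exact ⟨1, by simpa using hx⟩
  | one => exact ⟨0, by simpa using hT.one_mem⟩
  | mul x y _ _ hx hy =>
    obtain ⟨m, a, ha, s, hs, rfl⟩ := hx
    obtain ⟨n, b, hb, t, ht, rfl⟩ := hy
    obtain ⟨b', hb', s', hs', e⟩ := hT.iInter_mul_pow_subset n (Set.mul_mem_mul hs hb)
    refine ⟨m + n, a * b', ?_, s' * t, hT.mul_mem_iInter hs' ht, ?_⟩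
    · rw [pow_add]
      exact Set.mul_mem_mul ha hb'
    · simp only at e ⊢
      rw [mul_assoc, ← mul_assoc b', e]
      simp only [mul_assoc]
  | inv x _ hx =>
    obtain ⟨m, a, ha, s, hs, rfl⟩ := hx
    refine ⟨m, hT.iInter_mul_pow_subset m ?_⟩
    simp only [mul_inv_rev]
    refine Set.mul_mem_mul (hT.inv_mem_iInter hs) ?_
    rw [← hA.2, inv_pow]
    simpa using ha

end IsThickeningSequence

/-- A descending sequence of approximate subgroups, normalised by `A` and of finite index in each
power of `A`, which approximates a type-definable subgroup. -/
structure IsNormalChain (𝔾 : M.DefinableGroup G) (A : Set G) (T R : ℕ → Set G) : Prop where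
  definable : ∀ n, 𝔾.IsDefinable (R n)
  mul_subset : ∀ n, R (n + 1) * R (n + 1) ⊆ R n
  inv_subset : ∀ n, (R (n + 1))⁻¹ ⊆ R n
  conj_subset : ∀ n, ∀ a ∈ A, ∀ x ∈ R (n + 1), a⁻¹ * x * a ∈ R n
  iInter_subset : ∀ n, ⋂ j, T j ⊆ R n
  subset_four : ∀ n, R (n + 1) ⊆ A ^ 4 * T n
  covers : ∀ n m, ∃ F ⊆ A ^ m, F.Finite ∧ A ^ m * (⋂ j, T j) ⊆ F * R n

theorem IsFiniteRoughAmenable.exists_thick_chain (h : IsFiniteRoughAmenable 𝔾 A T μ)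
    (j : ℕ → ℕ) : ∃ Z W : ℕ → Set G, (∀ n, IsThickSubset 𝔾 A (Z n)) ∧
      (∀ n, ∀ a ∈ A, ∀ z ∈ Z (n + 1), a⁻¹ * z * a ∈ W n) ∧
      (∀ n, W n ^ 8 ⊆ Z n ^ 4 * T (j n)) ∧ ∀ n, W n ^ 8 ⊆ A ^ 4 * T (j n) := by
  choose f hf W hconj hW hWA using fun (Z : {Z : Set G // IsThickSubset 𝔾 A Z}) (n : ℕ) =>
    h.exists_thick_step Z.2 (j n)
  obtain ⟨Z, hZ⟩ : ∃ Z : ℕ → {Z : Set G // IsThickSubset 𝔾 A Z},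
      ∀ n, (Z (n + 1) : Set G) = f (Z n) n :=
    ⟨fun n => Nat.rec ⟨A, h.isThickSubset_self⟩ (fun n Z => ⟨f Z n, hf Z n⟩) n, fun _ => rfl⟩
  refine ⟨fun n => Z n, fun n => W (Z n) n, fun n => (Z n).2, fun n => ?_,
    fun n => hW (Z n) n, fun n => hWA (Z n) n⟩
  simpa only [hZ] using hconj (Z n) n

/-- Up to thickening, `R (n + 1) ^ 2` is `Z (n + 1) ^ 8 ⊆ W n ^ 8`, which returns to `Z n ^ 4`;
conjugates of `Z (n + 1) ^ 4` lie in `W n ^ 4`. The spacing `10 = 8 + 1 + 1` pays for moving past `Z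
(n + 1) ^ 4 ⊆ A ^ 8` and for two products. -/
theorem IsFiniteRoughAmenable.exists_isNormalChain (h : IsFiniteRoughAmenable 𝔾 A T μ) :
    ∃ R, IsNormalChain 𝔾 A T R := by
  have hT := h.thickening
  obtain ⟨Z, W, hZ, hconj', hW', hWA'⟩ := h.exists_thick_chain fun n => 10 * n + 1
  have hsub : ∀ n, Z (n + 1) ⊆ W n := fun n z hz => by
    simpa using hconj' n 1 h.symmetric.1 z hz
  have h48 : ∀ n, W n ^ 4 ⊆ W n ^ 8 := fun n =>
    Set.pow_subset_pow_right (hsub n (hZ (n + 1)).symmetric.1) (by norm_num)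
  have hT₂ : ∀ n, T (10 * n + 1) * T (10 * n + 1) ⊆ T (10 * n) := fun n => hT.sq_subset _
  have hanti : ∀ n, T (10 * (n + 1)) ⊆ T (10 * n + 1) := fun n => hT.antitone (by omega)
  refine ⟨fun n => Z n ^ 4 * T (10 * n), ?_, ?_, ?_, ?_, ?_, ?_, ?_⟩
  · exact fun n => ((hZ n).definable.pow 4).mul (hT.definable _)
  · intro n
    have h₁ : T (10 * (n + 1)) * Z (n + 1) ^ 4 ⊆ Z (n + 1) ^ 4 * T (10 * n + 2) :=
      hT.swap ((hZ _).pow_subset 4) (by omega)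
    have h₂ : T (10 * n + 2) * T (10 * (n + 1)) ⊆ T (10 * n + 1) :=
      hT.mul_subset (by omega) (by omega)
    calc Z (n + 1) ^ 4 * T (10 * (n + 1)) * (Z (n + 1) ^ 4 * T (10 * (n + 1)))
        = Z (n + 1) ^ 4 * (T (10 * (n + 1)) * Z (n + 1) ^ 4) * T (10 * (n + 1)) := by
          simp only [mul_assoc]
      _ ⊆ Z (n + 1) ^ 4 * (Z (n + 1) ^ 4 * T (10 * n + 2)) * T (10 * (n + 1)) := by gcongr
      _ = Z (n + 1) ^ 8 * (T (10 * n + 2) * T (10 * (n + 1))) := by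
          rw [show Z (n + 1) ^ 8 = Z (n + 1) ^ 4 * Z (n + 1) ^ 4 by rw [← pow_add]]
          simp only [mul_assoc]
      _ ⊆ W n ^ 8 * T (10 * n + 1) :=
          Set.mul_subset_mul (Set.pow_subset_pow_left (hsub n)) h₂
      _ ⊆ Z n ^ 4 * T (10 * n + 1) * T (10 * n + 1) := Set.mul_subset_mul_right (hW' n)
      _ = Z n ^ 4 * (T (10 * n + 1) * T (10 * n + 1)) := mul_assoc _ _ _
      _ ⊆ Z n ^ 4 * T (10 * n) := Set.mul_subset_mul_left (hT₂ n)
  · intro n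
    have h₁ : T (10 * (n + 1)) * Z (n + 1) ^ 4 ⊆ Z (n + 1) ^ 4 * T (10 * n + 1) :=
      hT.swap ((hZ _).pow_subset 4) (by omega)
    calc (Z (n + 1) ^ 4 * T (10 * (n + 1)))⁻¹ = T (10 * (n + 1)) * Z (n + 1) ^ 4 := by
          rw [mul_inv_rev, hT.inv_eq, (hZ _).pow_inv]
      _ ⊆ Z (n + 1) ^ 4 * T (10 * n + 1) := h₁
      _ ⊆ W n ^ 8 * T (10 * n + 1) :=
          Set.mul_subset_mul_right ((Set.pow_subset_pow_left (hsub n)).trans (h48 n))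
      _ ⊆ Z n ^ 4 * T (10 * n + 1) * T (10 * n + 1) := Set.mul_subset_mul_right (hW' n)
      _ = Z n ^ 4 * (T (10 * n + 1) * T (10 * n + 1)) := mul_assoc _ _ _
      _ ⊆ Z n ^ 4 * T (10 * n) := Set.mul_subset_mul_left (hT₂ n)
  · rintro n a ha _ ⟨z, hz, t, ht, rfl⟩
    have hpow : ∀ k, ∀ z ∈ Z (n + 1) ^ k, a⁻¹ * z * a ∈ W n ^ k := by
      intro k
      induction k with
      | zero =>
        intro z hz
        obtain rfl : z = 1 := by simpa using hz
        simp
      | succ k ih =>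
        intro z hz
        rw [pow_succ] at hz ⊢
        obtain ⟨y, hy, z, hz, rfl⟩ := hz
        exact ⟨_, ih y hy, _, hconj' n a ha z hz, by simp [mul_assoc]⟩
    have h₁ := hW' n (h48 n (hpow 4 z hz))
    have h₂ := hT.conj_subset (10 * n + 1) a ha t (hT.antitone (by omega) ht)
    have h₃ := Set.mul_mem_mul h₁ h₂
    rw [mul_assoc] at h₃
    convert Set.mul_subset_mul_left (hT₂ n) h₃ using 1
    simp only
    group
  · exact fun n t ht => ⟨1, Set.one_mem_pow (hZ n).symmetric.1, t, Set.mem_iInter.1 ht _, one_mul t⟩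
  · intro n
    have h₁ : T (10 * n + 1) * T (10 * (n + 1)) ⊆ T n :=
      hT.mul_subset (by omega) (by omega)
    calc Z (n + 1) ^ 4 * T (10 * (n + 1)) ⊆ W n ^ 8 * T (10 * (n + 1)) :=
          Set.mul_subset_mul_right ((Set.pow_subset_pow_left (hsub n)).trans (h48 n))
      _ ⊆ A ^ 4 * T (10 * n + 1) * T (10 * (n + 1)) := Set.mul_subset_mul_right (hWA' n)
      _ = A ^ 4 * (T (10 * n + 1) * T (10 * (n + 1))) := mul_assoc _ _ _
      _ ⊆ A ^ 4 * T n := Set.mul_subset_mul_left h₁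
  · intro n m
    obtain ⟨F, hFA, hF, hAF⟩ := h.exists_cover_sq (hZ n) m (10 * n + 1)
    refine ⟨F, hFA, hF, ?_⟩
    calc A ^ m * (⋂ j, T j) ⊆ F * (Z n ^ 2 * T (10 * n + 1)) * T (10 * n + 1) :=
          Set.mul_subset_mul hAF (Set.iInter_subset _ _)
      _ = F * (Z n ^ 2 * (T (10 * n + 1) * T (10 * n + 1))) := by simp only [mul_assoc]
      _ ⊆ F * (Z n ^ 4 * T (10 * n)) := Set.mul_subset_mul_left (Set.mul_subset_mul
          (Set.pow_subset_pow_right (hZ n).symmetric.1 (by norm_num)) (hT₂ n))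

namespace IsNormalChain

variable {R : ℕ → Set G}

theorem one_mem (hR : IsNormalChain 𝔾 A T R) (hT : IsThickeningSequence 𝔾 A T) (n : ℕ) :
    (1 : G) ∈ R n := hR.iInter_subset n hT.one_mem_iInter

theorem antitone (hR : IsNormalChain 𝔾 A T R) (hT : IsThickeningSequence 𝔾 A T) : Antitone R :=
  antitone_nat_of_succ_le fun n =>
    (Set.subset_mul_left _ (hR.one_mem hT (n + 1))).trans (hR.mul_subset n)

/-- The intersection of a normal chain. -/
def subgroup (hR : IsNormalChain 𝔾 A T R) (hT : IsThickeningSequence 𝔾 A T) : Subgroup G where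
  carrier := ⋂ n, R n
  one_mem' := Set.mem_iInter.2 (hR.one_mem hT)
  mul_mem' hx hy := Set.mem_iInter.2 fun n => hR.mul_subset n
    (Set.mul_mem_mul (Set.mem_iInter.1 hx _) (Set.mem_iInter.1 hy _))
  inv_mem' hx := Set.mem_iInter.2 fun n => hR.inv_subset n
    (Set.inv_mem_inv.2 (Set.mem_iInter.1 hx _))

theorem coe_subgroup (hR : IsNormalChain 𝔾 A T R) (hT : IsThickeningSequence 𝔾 A T) :
    (hR.subgroup hT : Set G) = ⋂ n, R n := rfl

theorem mem_subgroup (hR : IsNormalChain 𝔾 A T R) (hT : IsThickeningSequence 𝔾 A T) {x : G} :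
    x ∈ hR.subgroup hT ↔ ∀ n, x ∈ R n := Set.mem_iInter

theorem closure_le_normalizer (hR : IsNormalChain 𝔾 A T R) (hT : IsThickeningSequence 𝔾 A T)
    (hA : IsSymmetricSet A) :
    Subgroup.closure (A * ⋂ j, T j) ≤ Subgroup.normalizer (hR.subgroup hT : Set G) := by
  have hconj : ∀ a ∈ A, ∀ x ∈ hR.subgroup hT, a⁻¹ * x * a ∈ hR.subgroup hT := by
    intro a ha x hx
    rw [mem_subgroup] at hx ⊢
    exact fun n => hR.conj_subset n a ha x (hx _)
  rw [Subgroup.closure_le]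
  rintro _ ⟨a, ha, t, ht, rfl⟩
  refine mul_mem ?_ (Subgroup.le_normalizer ((hR.mem_subgroup hT).2 fun n => hR.iInter_subset n ht))
  have ha' : a⁻¹ ∈ A := by
    rw [← hA.2]
    simpa using ha
  refine Subgroup.mem_normalizer_iff.2 fun x => ⟨fun hx => by simpa using hconj _ ha' x hx,
    fun hx => by simpa [mul_assoc] using hconj a ha _ hx⟩

/-- All covers together use countably many centres, and a coset is determined by the sequence of
centres chosen for a representative. Equality at index `n + 2` leaves one step for the inverse and
one for the product. -/
theorem mk_quotient_le (hR : IsNormalChain 𝔾 A T R) (hT : IsThickeningSequence 𝔾 A T)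
    (hA : IsSymmetricSet A) (K : Subgroup G) (hK : K = Subgroup.closure (A * ⋂ j, T j)) :
    #(K ⧸ (hR.subgroup hT).subgroupOf K) ≤ 2 ^ ℵ₀ := by
  choose F hFA hF hcov using hR.covers
  let S : Set G := ⋃ n, ⋃ m, F n m
  have hS : S.Countable := Set.countable_iUnion fun n => Set.countable_iUnion fun m =>
    (hF n m).countable
  have hex : ∀ x : K, ∀ n, ∃ s : S, (s : G)⁻¹ * x ∈ R n := by
    rintro ⟨x, hx⟩ n
    rw [hK] at hx
    obtain ⟨m, hm⟩ := hT.exists_mem_of_mem_closure hA hx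
    obtain ⟨s, hs, r, hr, e⟩ := hcov n m hm
    refine ⟨⟨s, Set.mem_iUnion₂.2 ⟨n, m, hs⟩⟩, ?_⟩
    simp only at e ⊢
    rwa [← e, inv_mul_cancel_left]
  choose c hc using hex
  have hinj : Function.Injective fun q : K ⧸ (hR.subgroup hT).subgroupOf K => c q.out := by
    intro p q hpq
    rw [← Quotient.out_eq p, ← Quotient.out_eq q]
    refine QuotientGroup.eq.2 ?_
    rw [Subgroup.mem_subgroupOf, mem_subgroup]
    intro n
    have h₁ := hR.inv_subset _ (Set.inv_mem_inv.2 (hc p.out (n + 2)))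
    have h₂ := hc q.out (n + 1)
    have h₃ := congrFun hpq (n + 2)
    have h₄ := hR.antitone hT (Nat.le_succ (n + 1)) (hc q.out (n + 2))
    simp only at h₃
    rw [← h₃] at h₄
    convert hR.mul_subset n (Set.mul_mem_mul h₁ h₄) using 1
    push_cast
    group
  refine (Cardinal.mk_le_of_injective hinj).trans ?_
  rw [Cardinal.mk_arrow, Cardinal.mk_nat, Cardinal.lift_aleph0, Cardinal.two_power_aleph0,
    ← Cardinal.aleph0_power_aleph0]
  exact Cardinal.power_le_power_right (by simpa using hS)

end IsNormalChain

end RoughAmenable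

theorem mainTheorem3 {L : MSLanguage.{u}} {M : L.Struc} (κ : Cardinal.{u}) (hκ : ℵ₀ < κ)
    (hL : L.card ≤ κ) (hM : M.Saturated κ) {G : Type u} [Group G] (𝔾 : M.DefinableGroup G)
    (A : Set G) (hA : 𝔾.IsDefinable A) (hAsymm : IsSymmetricSet A)
    (T : ℕ → Set G) (hT : IsThickeningSequence 𝔾 A T)
    (μ : ℕ → Set G → ℝ≥0∞) (hμ : IsRoughAmenabilityWitness 𝔾 A T μ)
    (hfin : ∀ i : ℕ, typeMeasure 𝔾 (μ i) (A ^ 4 * ⋂ j, T j) < ∞) :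
    (∀ m i : ℕ, μ i (A ^ m) < ∞) ∧
      ∃ N : Subgroup G,
        𝔾.IsTypeDefinable κ (N : Set G) ∧
        N ≤ Subgroup.closure (A * ⋂ j, T j) ∧
        (N.subgroupOf (Subgroup.closure (A * ⋂ j, T j))).Normal ∧
        HasBoundedIndex 𝔾 N (A * ⋂ j, T j) ∧
        (⋂ j, T j) ⊆ (N : Set G) ∧
        (N : Set G) ⊆ A ^ 4 * ⋂ j, T j := by
  have h : IsFiniteRoughAmenable 𝔾 A T μ :=
    ⟨hA, hAsymm, hT, hμ.isInvariantRoughMeasure hA, hμ.normalised, fun i =>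
      typeMeasure_lt_top_exists hκ hM hA hT (hμ.rough i) (hfin i)⟩
  obtain ⟨R, hR⟩ := h.exists_isNormalChain
  have hfour : (hR.subgroup hT : Set G) ⊆ A ^ 4 * ⋂ j, T j := by
    rw [← MSLanguage.Struc.DefinableGroup.iInter_mul_eq hκ hM hT.definable hT.antitone (hA.pow 4)]
    exact Set.subset_iInter fun n => (Set.iInter_subset _ (n + 1)).trans (hR.subset_four n)
  refine ⟨h.measure_pow_lt_top, hR.subgroup hT, ⟨ULift ℕ, fun n => R n.down, by simpa using hκ,
    fun n => hR.definable _, ?_⟩, ?_, ?_, ⟨hR.mk_quotient_le hT hAsymm _ rfl, ?_⟩, ?_, hfour⟩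
  · rw [hR.coe_subgroup]
    exact (Equiv.ulift.iInf_congr fun _ => rfl).symm
  · exact fun x hx => hT.pow_mul_subset_closure hAsymm 4 (hfour hx)
  · exact Subgroup.normal_subgroupOf_of_le_normalizer (hR.closure_le_normalizer hT hAsymm)
  · intro D hD hND n
    rw [hR.coe_subgroup] at hND
    -- By compactness `D` contains some `R k`, whose finite covers then serve for `D`.
    obtain ⟨k, hk⟩ := MSLanguage.Struc.DefinableGroup.exists_subset_of_iInter_subset hκ hM
      hR.definable (hR.antitone hT) hD hND
    obtain ⟨F, hFA, hF, hcov⟩ := hR.covers k n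
    exact ⟨F, hF, hFA.trans (hT.pow_subset_closure n), (hT.mul_iInter_pow_subset n).trans
      (hcov.trans (Set.mul_subset_mul_left hk))⟩
  · exact Set.subset_iInter hR.iInter_subset
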